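/- **The KPA model.** Let $K,n_0\ge 1$ be integers, let $q\in[0,1]$, $\gamma,\alpha\in(0,1]$, and let $p_1,\dots,p_K\ge 0$ with $\sum_k p_k=1$ be such that every $p_kn_0$ is an integer. The graph $G_0$ has $n_0$ nodes, $p_kn_0$ of them in group $k$ for each $k$, and every node of $G_0$ is given degree one by convention; every edge added later contributes one to the degree of each of its endpoints (a loop contributes two). Write $d_i(t)$ for the degree of node $i$ in $G_t$. Given $G_0,\dots,G_{t-1}$, the graph $G_t$ is formed as follows. With probability $q$ (vertex-step) a new node $w$ arrives, whose group is $k$ with probability $p_k$; with probability $1-q$ (edge-step) an old node $w$ is picked with probability $d_w(t-1)/\sum_i d_i(t-1)$. Then $w$ is connected by a new edge to a node $u$ of $G_{t-1}$ (possibly $u=w$ in an edge-step), determined thus: first a node $u_1$ is proposed with probability $d_{u_1}(t-1)/\sum_i d_i(t-1)$; it is accepted for certain if it is in the group of $w$, and with probability $\gamma$ otherwise. After a rejection new proposals are made independently until one is accepted: with probability $\alpha$ a node of the group of $w$ is proposed and with probability $1-\alpha$ a node of the other groups, in both cases with probability proportional to its degree in $G_{t-1}$ within that class; the acceptance rule is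 the same as before. All nodes keep their groups. **Theorem.** Let $m_d^k(t)$ be the number of nodes of group $k$ that have degree $d$ in $G_t$; thus $m_1^k(0)=p_kn_0$ and $m_0^k(t)=0$ almost surely. For every $k\in\{1,\dots,K\}$ and every $d\ge1$ the limit $M_d^k=\lim_{t\to\infty}E[m_d^k(t)]/t$ exists, and $$M_d^k=\frac{2qp_k}{4-q}\prod_{j=2}^{d}\frac{(j-1)(2-q)}{2+j(2-q)} .$$ If $q>0$ and $p_k>0$, then $M_d^k$ decays like $d^{-\beta}$ with $\beta=1+\frac{2}{2-q}$, the same exponent for every group: there is a constant $C>0$, which may depend on $q$ and $p_k$ but not on $d$, such that $M_d^k\big/\bigl(C\,d^{-\beta}\bigr)\to 1$ as $d\to\infty$. -/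

import Mathlib

open MeasureTheory Filter Topology Asymptotics

noncomputable section

/-- A labelled multigraph that has grown out of `n₀` initial nodes. The nodes are the elements of
`Fin (n₀ + added)`: the first `n₀` are the initial ones, the others are numbered in their order of
arrival. Every node carries a group label in `Fin K`. The list `edges` holds the added edges
`(w, u)`, the most recent one first; loops and repeated edges may occur. -/
@[ext]
structure Network (K n₀ : ℕ) where
  added : ℕ
  group : Fin (n₀ + added) → Fin K
  edges : List (Fin (n₀ + added) × Fin (n₀ + added))

namespace Network

variable {K n₀ : ℕ}

/-- The networks form a countable set, which is given its discrete sigma-algebra. -/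
instance : MeasurableSpace (Network K n₀) := ⊤

/-- The nodes of a network. -/
abbrev Node (G : Network K n₀) : Type := Fin (n₀ + G.added)

/-- The initial network: `n₀` nodes with the given group labels and no added edge. -/
def initial (σ : Fin n₀ → Fin K) : Network K n₀ where
  added := 0
  group := σ
  edges := []

/-- A new node (the last one) of group `g` arrives and is joined to the old node `u`. -/
def addNode (G : Network K n₀) (g : Fin K) (u : G.Node) : Network K n₀ where
  added := G.added + 1
  group := Fin.snoc (α := fun _ => Fin K) G.group g
  edges := (Fin.last (n₀ + G.added), u.castSucc) ::
    G.edges.map (fun e => (e.1.castSucc, e.2.castSucc))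

/-- A new edge `(w, u)` is added between old nodes. -/
def addEdge (G : Network K n₀) (w u : G.Node) : Network K n₀ where
  added := G.added
  group := G.group
  edges := (w, u) :: G.edges

/-- The degree of a node: each of the `n₀` initial nodes starts with degree one, and every endpoint
of an added edge counts once (so a loop at `v` counts twice). -/
def degree (G : Network K n₀) (v : G.Node) : ℕ :=
  (if v.val < n₀ then 1 else 0) +
    (G.edges.map (fun e => (if e.1 = v then 1 else 0) + (if e.2 = v then 1 else 0))).sum

/-- The sum of the degrees of all nodes. -/
def totalDegree (G : Network K n₀) : ℕ := ∑ v : G.Node, G.degree v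

/-- The sum of the degrees of the nodes of group `g`. -/
def sameDegree (G : Network K n₀) (g : Fin K) : ℕ :=
  ∑ v : G.Node with G.group v = g, G.degree v

/-- The sum of the degrees of the nodes outside group `g`. -/
def otherDegree (G : Network K n₀) (g : Fin K) : ℕ :=
  ∑ v : G.Node with G.group v ≠ g, G.degree v

/-- The number of nodes of group `k` and degree `d`. -/
def countDegree (G : Network K n₀) (k : Fin K) (d : ℕ) : ℕ :=
  (Finset.univ.filter (fun v : G.Node => G.group v = k ∧ G.degree v = d)).card

/-- Selection proportional to the degree: the probability that `u` is picked. -/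
def pickProb (G : Network K n₀) (u : G.Node) : ℝ :=
  (G.degree u : ℝ) / (G.totalDegree : ℝ)

/-- The probability that a node `w` of group `g` accepts the proposed node `u`: certain inside the
group, `γ` outside. -/
def acceptProb (γ : ℝ) (G : Network K n₀) (g : Fin K) (u : G.Node) : ℝ :=
  if G.group u = g then 1 else γ

/-- The probability that `u` is proposed to a node `w` of group `g` in any attempt after the first
one: with probability `α` a node of the same group is proposed, with probability `1 - α` a node of
another group, in both cases proportionally to the degree. -/
def retryProb (α : ℝ) (G : Network K n₀) (g : Fin K) (u : G.Node) : ℝ :=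
  if G.group u = g then α * ((G.degree u : ℝ) / (G.sameDegree g : ℝ))
  else (1 - α) * ((G.degree u : ℝ) / (G.otherDegree g : ℝ))

/-- The probability that a node `w` of group `g` rejects a proposal drawn from `π`. -/
def rejectProb (γ : ℝ) (G : Network K n₀) (g : Fin K) (π : G.Node → ℝ) : ℝ :=
  ∑ u : G.Node, π u * (1 - G.acceptProb γ g u)

/-- The probability that the procedure of proposals to a node `w` of group `g`, repeated until the
first acceptance, ends with the edge `(w, u)`. Either the first proposal is `u` and is accepted, or
it is rejected and then, for some `j`, exactly `j` further proposals are rejected before the next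
one is `u` and is accepted. -/
def connectProb (γ α : ℝ) (G : Network K n₀) (g : Fin K) (u : G.Node) : ℝ :=
  G.pickProb u * G.acceptProb γ g u +
    G.rejectProb γ g G.pickProb *
      ∑' j : ℕ, G.rejectProb γ g (G.retryProb α g) ^ j *
        (G.retryProb α g u * G.acceptProb γ g u)

open Classical in
/-- The probability of passing from `G` to `G'` in one time step. With probability `q` there is a
vertex-step: a new node arrives, its group is `g` with probability `p g`, and it is connected to an
old node. With probability `1 - q` there is an edge-step: an old node `w` is picked proportionally
to its degree and is connected to an old node. -/
def stepProb (q : ℝ) (p : Fin K → ℝ) (γ α : ℝ) (G G' : Network K n₀) : ℝ :=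
  q * (∑ g : Fin K, ∑ u : G.Node,
      if G' = G.addNode g u then p g * G.connectProb γ α g u else 0) +
    (1 - q) * (∑ w : G.Node, ∑ u : G.Node,
      if G' = G.addEdge w u then G.pickProb w * G.connectProb γ α (G.group w) u else 0)

end Network

/-- `G` is the evolving network of the KPA model on the probability space `(Ω, P)`, started from
`n₀` nodes of degree one with group labels `σ`: the random networks `G 0, G 1, …` form the Markov
chain with transition probabilities `Network.stepProb q p γ α`. -/
structure IsKPAProcess {Ω : Type*} [MeasurableSpace Ω] (P : Measure Ω) {K n₀ : ℕ}
    (q : ℝ) (p : Fin K → ℝ) (γ α : ℝ) (σ : Fin n₀ → Fin K)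
    (G : ℕ → Ω → Network K n₀) : Prop where
  measurable : ∀ t, Measurable (G t)
  start : ∀ᵐ ω ∂P, G 0 ω = Network.initial σ
  step : ∀ (t : ℕ) (h : ℕ → Network K n₀),
    P.real {ω | ∀ s ≤ t + 1, G s ω = h s} =
      P.real {ω | ∀ s ≤ t, G s ω = h s} * Network.stepProb q p γ α (h t) (h (t + 1))

end

/-! Summing the geometric series over rejected proposals shows how the preference for the own group
acts. Write `T` for the total degree and `S` for the degree sum of group `k`. A node `v` of group
`k` is the second endpoint with probability `deg v * (1/T + bias * q * (p k / S - 1/T))`, by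
`second_endpoint_prob`. If `S = p k * T`, this is plain preferential attachment, and `γ` and `α`
disappear from the answer.

The balance holds up to `o(T)` in mean. The conditional drift of `y = S - p k * T` is at most `(2 -
q) * y / T` in the direction of `y`, while `T` grows by 2 per step. Hence `E[y^2]` is `O(T^(2 -
q/2))` for `q > 0` (`stepMean_excess_sq_le`, `le_rpow_of_succ_le`), and `q * E|y| / T` tends to 0.
For `q = 0` the factor `q` removes the term.

The means `e d` of the degree counts then satisfy `e d (t+1) = e d t + q * p k * [d = 1] + (2 - q) /
T * ((d-1) * e (d-1) t - d * e d t) + o(1)`; a loop can disturb a count only at a node of degree at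
most `d`, which costs `O(d/T)` (`abs_stepMean_countDegree_le`). With `T = n₀ + 2t` this is a
first-order linear recursion in `t`, whose growth rate is given by
`tendsto_div_of_linear_recursion`; induction on `d` gives the product. Its power law is Euler's
limit formula for `Γ` at `s = 2 / (2 - q)`. -/

namespace Network

/-! ### Degrees, degree sums and degree counts under one step -/

variable {K n₀ : ℕ}

/-- The degree of `v` given by the list `l` of added edges, if the first `n₀` nodes start with
degree one. -/
def listDegree {N : ℕ} (n₀ : ℕ) (l : List (Fin N × Fin N)) (v : Fin N) : ℕ :=
  (if v.val < n₀ then 1 else 0) +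
    (l.map (fun e => (if e.1 = v then 1 else 0) + (if e.2 = v then 1 else 0))).sum

theorem listDegree_cons {N : ℕ} (n₀ : ℕ) (l : List (Fin N × Fin N)) (w u v : Fin N) :
    listDegree n₀ ((w, u) :: l) v =
      listDegree n₀ l v + ((if w = v then 1 else 0) + if u = v then 1 else 0) := by
  simp only [listDegree, List.map_cons, List.sum_cons]
  omega

theorem listDegree_map_castSucc {N : ℕ} (n₀ : ℕ) (l : List (Fin N × Fin N)) (v : Fin N) :
    listDegree n₀ (l.map (fun e => (e.1.castSucc, e.2.castSucc))) v.castSucc =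
      listDegree n₀ l v := by
  simp only [listDegree, List.map_map, Function.comp_def, Fin.val_castSucc, Fin.castSucc_inj]

theorem listDegree_map_last {N n₀ : ℕ} (h : n₀ ≤ N) (l : List (Fin N × Fin N)) :
    listDegree n₀ (l.map (fun e => (e.1.castSucc, e.2.castSucc))) (Fin.last N) = 0 := by
  have hl : ∀ v : Fin N, ¬ v.castSucc = Fin.last N := fun v => (Fin.castSucc_lt_last v).ne
  simp [listDegree, List.map_map, Function.comp_def, hl, h]

theorem degree_addNode_castSucc (G : Network K n₀) (g : Fin K) (u v : G.Node) :
    (G.addNode g u).degree (Fin.castSucc v) = G.degree v + if u = v then 1 else 0 := by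
  have hl : ¬ Fin.last (n₀ + G.added) = v.castSucc := (Fin.castSucc_lt_last v).ne'
  refine (listDegree_cons n₀ _ (Fin.last (n₀ + G.added)) u.castSucc v.castSucc).trans ?_
  rw [listDegree_map_castSucc, if_neg hl, zero_add]
  simp only [Fin.castSucc_inj]
  rfl

theorem degree_addNode_last (G : Network K n₀) (g : Fin K) (u : G.Node) :
    (G.addNode g u).degree (Fin.last (n₀ + G.added)) = 1 := by
  have hl : ¬ u.castSucc = Fin.last (n₀ + G.added) := (Fin.castSucc_lt_last u).ne
  refine (listDegree_cons n₀ _ (Fin.last (n₀ + G.added)) u.castSucc _).trans ?_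
  rw [listDegree_map_last (Nat.le_add_right _ _), if_neg hl, if_pos rfl]

theorem degree_addEdge (G : Network K n₀) (w u v : G.Node) :
    (G.addEdge w u).degree v =
      G.degree v + ((if w = v then 1 else 0) + if u = v then 1 else 0) :=
  listDegree_cons n₀ G.edges w u v

/-- The sum over all nodes of a function of the group and the degree. -/
def nodeSum {M : Type*} [AddCommMonoid M] (φ : Fin K → ℕ → M) (G : Network K n₀) : M :=
  ∑ v : G.Node, φ (G.group v) (G.degree v)

theorem nodeSum_addNode {M : Type*} [AddCommMonoid M] (φ : Fin K → ℕ → M) (G : Network K n₀)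
    (g : Fin K) (u : G.Node) :
    (G.addNode g u).nodeSum φ =
      ∑ v : G.Node, φ (G.group v) (G.degree v + if u = v then 1 else 0) + φ g 1 := by
  refine (Fin.sum_univ_castSucc (n := n₀ + G.added)
    (fun v => φ ((G.addNode g u).group v) ((G.addNode g u).degree v))).trans ?_
  congr 1
  · refine Finset.sum_congr rfl fun v _ => ?_
    rw [degree_addNode_castSucc]
    simp [addNode]
  · rw [degree_addNode_last]
    simp [addNode]

theorem nodeSum_addEdge {M : Type*} [AddCommMonoid M] (φ : Fin K → ℕ → M) (G : Network K n₀)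
    (w u : G.Node) :
    (G.addEdge w u).nodeSum φ =
      ∑ v : G.Node, φ (G.group v)
        (G.degree v + ((if w = v then 1 else 0) + if u = v then 1 else 0)) := by
  exact Finset.sum_congr rfl fun v _ => congrArg (φ (G.group v)) (degree_addEdge G w u v)

theorem totalDegree_eq_nodeSum (G : Network K n₀) :
    G.totalDegree = G.nodeSum (fun _ n => n) := rfl

theorem sameDegree_eq_nodeSum (G : Network K n₀) (k : Fin K) :
    G.sameDegree k = G.nodeSum (fun g n => if g = k then n else 0) := by
  simp [sameDegree, nodeSum, Finset.sum_filter]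

theorem countDegree_eq_nodeSum (G : Network K n₀) (k : Fin K) (d : ℕ) :
    (G.countDegree k d : ℝ) = G.nodeSum (fun g n => if g = k ∧ n = d then (1 : ℝ) else 0) := by
  simp [countDegree, nodeSum]

theorem totalDegree_addNode (G : Network K n₀) (g : Fin K) (u : G.Node) :
    (G.addNode g u).totalDegree = G.totalDegree + 2 := by
  rw [totalDegree_eq_nodeSum, nodeSum_addNode, Finset.sum_add_distrib]
  simp [totalDegree]

theorem totalDegree_addEdge (G : Network K n₀) (w u : G.Node) :
    (G.addEdge w u).totalDegree = G.totalDegree + 2 := by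
  rw [totalDegree_eq_nodeSum, nodeSum_addEdge, Finset.sum_add_distrib, Finset.sum_add_distrib]
  simp [totalDegree]

theorem sameDegree_addNode (G : Network K n₀) (k g : Fin K) (u : G.Node) :
    (G.addNode g u).sameDegree k =
      G.sameDegree k + ((if g = k then 1 else 0) + if G.group u = k then 1 else 0) := by
  have h : ∀ v : G.Node, (if G.group v = k then G.degree v + (if u = v then 1 else 0) else 0) =
      (if G.group v = k then G.degree v else 0) +
        if u = v then (if G.group u = k then 1 else 0) else 0 := fun v => by
    by_cases huv : u = v
    · subst huv; split_ifs <;> simp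
    · simp [huv]
  rw [sameDegree_eq_nodeSum, nodeSum_addNode, Finset.sum_congr rfl fun v _ => h v,
    Finset.sum_add_distrib, sameDegree_eq_nodeSum, nodeSum]
  simp
  ring

theorem sameDegree_addEdge (G : Network K n₀) (k : Fin K) (w u : G.Node) :
    (G.addEdge w u).sameDegree k = G.sameDegree k +
      ((if G.group w = k then 1 else 0) + if G.group u = k then 1 else 0) := by
  have h : ∀ v : G.Node, (if G.group v = k then
        G.degree v + ((if w = v then 1 else 0) + if u = v then 1 else 0) else 0) =
      (if G.group v = k then G.degree v else 0) +
        ((if w = v then (if G.group w = k then 1 else 0) else 0) +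
          if u = v then (if G.group u = k then 1 else 0) else 0) := fun v => by
    by_cases hwv : w = v <;> by_cases huv : u = v <;> by_cases hv : G.group v = k <;>
      simp_all
  rw [sameDegree_eq_nodeSum, nodeSum_addEdge, Finset.sum_congr rfl fun v _ => h v,
    Finset.sum_add_distrib, Finset.sum_add_distrib, sameDegree_eq_nodeSum, nodeSum]
  simp

theorem sameDegree_add_otherDegree (G : Network K n₀) (g : Fin K) :
    G.sameDegree g + G.otherDegree g = G.totalDegree :=
  Finset.sum_filter_add_sum_filter_not _ _ _

/-- Keeps the flow of nodes between degrees bounded by the degree sum of the group, so that `p k /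
S` can be multiplied by it even when `S` is small. -/
theorem mul_countDegree_le_sameDegree (G : Network K n₀) (k : Fin K) (d : ℕ) :
    d * G.countDegree k d ≤ G.sameDegree k := by
  rw [sameDegree_eq_nodeSum, countDegree, Finset.card_filter, Finset.mul_sum, nodeSum]
  refine Finset.sum_le_sum fun v _ => ?_
  split_ifs <;> simp_all

/-- The properties that the networks have, almost surely, after `t` steps. -/
structure Admissible (p : Fin K → ℝ) (t : ℕ) (G : Network K n₀) : Prop where
  totalDegree_eq : G.totalDegree = n₀ + 2 * t
  degree_pos : ∀ v, 0 < G.degree v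
  weight_pos : ∀ v, 0 < p (G.group v)
  exists_node : ∀ g, 0 < p g → ∃ v, G.group v = g

theorem degree_initial (σ : Fin n₀ → Fin K) (v : (initial σ).Node) :
    (initial σ).degree v = 1 := by
  have : v.val < n₀ := v.isLt
  simp [degree, initial, this]

theorem sameDegree_initial (σ : Fin n₀ → Fin K) (k : Fin K) :
    (initial σ).sameDegree k = (Finset.univ.filter (fun i => σ i = k)).card := by
  simp only [sameDegree, degree_initial, Finset.sum_const, smul_eq_mul, mul_one]
  rfl

theorem countDegree_initial (σ : Fin n₀ → Fin K) (k : Fin K) :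
    (initial σ).countDegree k 1 = (Finset.univ.filter (fun i => σ i = k)).card := by
  simp only [countDegree, degree_initial, and_true]
  rfl

theorem Admissible.initial {p : Fin K → ℝ} (hn₀ : 0 < n₀) (σ : Fin n₀ → Fin K)
    (hσ : ∀ k, (((Finset.univ.filter (fun i => σ i = k)).card : ℕ) : ℝ) = p k * (n₀ : ℝ)) :
    Admissible p 0 (Network.initial σ) where
  totalDegree_eq := by
    simp only [totalDegree, degree_initial, Finset.sum_const, smul_eq_mul, mul_one, mul_zero,
      add_zero, Finset.card_univ]
    exact Fintype.card_fin n₀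
  degree_pos v := by rw [degree_initial]; exact one_pos
  weight_pos v := by
    have hn : (0 : ℝ) < n₀ := by exact_mod_cast hn₀
    refine pos_of_mul_pos_left ?_ hn.le
    rw [← hσ]
    exact Nat.cast_pos.2 <| Finset.card_pos.2
      ⟨(v : Fin n₀), Finset.mem_filter.2 ⟨Finset.mem_univ _, rfl⟩⟩
  exists_node g hg := by
    have hn : (0 : ℝ) < n₀ := by exact_mod_cast hn₀
    have h := mul_pos hg hn
    rw [← hσ] at h
    obtain ⟨i, hi⟩ := Finset.card_pos.1 (by exact_mod_cast h)
    exact ⟨i, (Finset.mem_filter.1 hi).2⟩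

theorem Admissible.addNode {p : Fin K → ℝ} {t : ℕ} {G : Network K n₀} (hG : G.Admissible p t)
    {g : Fin K} (hg : 0 < p g) (u : G.Node) : (G.addNode g u).Admissible p (t + 1) where
  totalDegree_eq := by rw [totalDegree_addNode, hG.totalDegree_eq]; ring
  degree_pos v := by
    refine Fin.lastCases (n := n₀ + G.added)
      (motive := fun v => 0 < (G.addNode g u).degree v) ?_ (fun i => ?_) v
    · rw [degree_addNode_last]; exact one_pos
    · rw [degree_addNode_castSucc]; exact Nat.add_pos_left (hG.degree_pos i) _
  weight_pos v := by
    refine Fin.lastCases (n := n₀ + G.added)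
      (motive := fun v => 0 < p ((G.addNode g u).group v)) ?_ (fun i => ?_) v
    · simpa [Network.addNode] using hg
    · simpa [Network.addNode] using hG.weight_pos i
  exists_node g' hg' := by
    obtain ⟨v, hv⟩ := hG.exists_node g' hg'
    exact ⟨Fin.castSucc v, by simpa [Network.addNode] using hv⟩

theorem Admissible.addEdge {p : Fin K → ℝ} {t : ℕ} {G : Network K n₀} (hG : G.Admissible p t)
    (w u : G.Node) : (G.addEdge w u).Admissible p (t + 1) where
  totalDegree_eq := by rw [totalDegree_addEdge, hG.totalDegree_eq]; ring
  degree_pos v := (Nat.add_pos_left (hG.degree_pos v) _).trans_eq (degree_addEdge G w u v).symm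
  weight_pos := hG.weight_pos
  exists_node := hG.exists_node

theorem Admissible.sameDegree_pos {p : Fin K → ℝ} {t : ℕ} {G : Network K n₀}
    (hG : G.Admissible p t) {g : Fin K} (hg : 0 < p g) : 0 < G.sameDegree g := by
  obtain ⟨v, hv⟩ := hG.exists_node g hg
  exact Finset.sum_pos' (fun _ _ => Nat.zero_le _) ⟨v, by simpa using hv, hG.degree_pos v⟩

theorem Admissible.countDegree_zero {p : Fin K → ℝ} {t : ℕ} {G : Network K n₀}
    (hG : G.Admissible p t) (k : Fin K) : G.countDegree k 0 = 0 := by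
  simp only [countDegree, Finset.card_eq_zero, Finset.filter_eq_empty_iff]
  exact fun v _ h => (hG.degree_pos v).ne' h.2

end Network

/-! ### Closed form of the connection probabilities -/

namespace Network

variable {K n₀ : ℕ}

/-- The effect of the preference for the own group: the probability that a fresh proposal to a node
of a group of degree share `x` is rejected and that the later proposals lead to a node of the own
group is `(1 - x) * bias γ α`. -/
noncomputable def bias (γ α : ℝ) : ℝ := (1 - γ) * (α / (α + γ - α * γ))

theorem bias_denom_pos {γ α : ℝ} (hγ0 : 0 < γ) (hα0 : 0 < α) (hα1 : α ≤ 1) :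
    0 < α + γ - α * γ := by
  nlinarith [mul_nonneg hγ0.le (sub_nonneg.2 hα1)]

theorem bias_nonneg {γ α : ℝ} (hγ0 : 0 < γ) (hγ1 : γ ≤ 1) (hα0 : 0 < α) (hα1 : α ≤ 1) :
    0 ≤ bias γ α :=
  mul_nonneg (sub_nonneg.2 hγ1) (div_nonneg hα0.le (bias_denom_pos hγ0 hα0 hα1).le)

theorem bias_le_one {γ α : ℝ} (hγ0 : 0 < γ) (hα0 : 0 < α) (hα1 : α ≤ 1) :
    bias γ α ≤ 1 := by
  have h : α / (α + γ - α * γ) ≤ 1 := by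
    rw [div_le_one (bias_denom_pos hγ0 hα0 hα1)]
    nlinarith [mul_nonneg hγ0.le (sub_nonneg.2 hα1)]
  exact mul_le_one₀ (by linarith) (div_nonneg hα0.le (bias_denom_pos hγ0 hα0 hα1).le) h

theorem sum_ite_group_degree (G : Network K n₀) (g : Fin K) (a b : ℝ) :
    ∑ u : G.Node, (G.degree u : ℝ) * (if G.group u = g then a else b) =
      G.sameDegree g * a + G.otherDegree g * b := by
  simp only [mul_ite, Finset.sum_ite, ← Finset.sum_mul, sameDegree, otherDegree, Nat.cast_sum]

theorem rejectProb_pickProb (γ : ℝ) (G : Network K n₀) (g : Fin K) :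
    G.rejectProb γ g G.pickProb = (1 - γ) * (G.otherDegree g / G.totalDegree) := by
  have h := G.sum_ite_group_degree g 0 ((1 - γ) / G.totalDegree)
  calc G.rejectProb γ g G.pickProb
      = ∑ u : G.Node, (G.degree u : ℝ) *
          (if G.group u = g then 0 else (1 - γ) / G.totalDegree) := by
        refine Finset.sum_congr rfl fun u _ => ?_
        rw [pickProb, acceptProb]
        split_ifs <;> ring
    _ = _ := by rw [h]; ring

/-- Retries are normalised separately inside and outside the group, so the rejection probability
does not depend on the network and the series over rejections is geometric. If no degree lay outside
the group, division by zero would make the value 0. -/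
theorem rejectProb_retryProb (γ α : ℝ) (G : Network K n₀) {g : Fin K} (hO : 0 < G.otherDegree g) :
    G.rejectProb γ g (G.retryProb α g) = (1 - α) * (1 - γ) := by
  have hO' : (G.otherDegree g : ℝ) ≠ 0 := by exact_mod_cast hO.ne'
  have h := G.sum_ite_group_degree g 0 ((1 - α) * (1 - γ) / G.otherDegree g)
  calc G.rejectProb γ g (G.retryProb α g)
      = ∑ u : G.Node, (G.degree u : ℝ) *
          (if G.group u = g then 0 else (1 - α) * (1 - γ) / G.otherDegree g) := by
        refine Finset.sum_congr rfl fun u _ => ?_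
        rw [retryProb, acceptProb]
        split_ifs <;> ring
    _ = _ := by rw [h]; field_simp; ring

theorem degree_le_sameDegree (G : Network K n₀) (u : G.Node) :
    G.degree u ≤ G.sameDegree (G.group u) :=
  Finset.single_le_sum (f := G.degree) (fun _ _ => Nat.zero_le _) (by simp)

theorem degree_le_otherDegree (G : Network K n₀) {g : Fin K} {u : G.Node} (h : G.group u ≠ g) :
    G.degree u ≤ G.otherDegree g :=
  Finset.single_le_sum (f := G.degree) (fun _ _ => Nat.zero_le _) (by simpa using h)

/-- The first proposal is rejected with probability `(1 - γ) * O / T`, where `O` is the degree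
outside the group; the retries sum to a factor `1 / (1 - (1 - α) * (1 - γ)) = 1 / (α + γ - α * γ)`.
The outcome stays proportional to the degree within each class: the preference only moves the
fraction `bias` of the outside mass into the own group. -/
theorem connectProb_eq {γ α : ℝ} (hγ0 : 0 < γ) (hγ1 : γ ≤ 1) (hα0 : 0 < α) (hα1 : α ≤ 1)
    (G : Network K n₀) (g : Fin K) {u : G.Node} (hu : 0 < G.degree u) :
    G.connectProb γ α g u = (G.degree u : ℝ) * ((if G.group u = g
      then 1 + bias γ α * (G.otherDegree g / G.sameDegree g) else 1 - bias γ α) /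
        G.totalDegree) := by
  have hD := bias_denom_pos hγ0 hα0 hα1
  -- With no degree outside the group, a node of positive degree must belong to it, and the first
  -- proposal is never rejected.
  rcases Nat.eq_zero_or_pos (G.otherDegree g) with hO | hO
  · have hg : G.group u = g := by
      by_contra h
      have := G.degree_le_otherDegree h
      omega
    simp [connectProb, rejectProb_pickProb, hO, hg, pickProb, acceptProb]
    ring
  · have hT : (0 : ℝ) < G.totalDegree := by
      have := G.sameDegree_add_otherDegree g
      exact_mod_cast (by omega : 0 < G.totalDegree)
    have hO' : (0 : ℝ) < G.otherDegree g := by exact_mod_cast hO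
    have hr0 : 0 ≤ (1 - α) * (1 - γ) := mul_nonneg (by linarith) (by linarith)
    have hr1 : 1 - (1 - α) * (1 - γ) = α + γ - α * γ := by ring
    rw [connectProb, rejectProb_pickProb, rejectProb_retryProb γ α G hO, tsum_mul_right,
      tsum_geometric_of_lt_one hr0 (by linarith), hr1, pickProb, acceptProb, retryProb, bias]
    split_ifs with hg
    · have hS : (0 : ℝ) < G.sameDegree g := by
        have := G.degree_le_sameDegree u
        rw [hg] at this
        exact_mod_cast hu.trans_le this
      field_simp
    · generalize hDe : α + γ - α * γ = D at hD ⊢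
      field_simp
      rw [← hDe]
      ring

theorem connectProb_nonneg {γ α : ℝ} (hγ0 : 0 < γ) (hγ1 : γ ≤ 1) (hα0 : 0 < α) (hα1 : α ≤ 1)
    (G : Network K n₀) (g : Fin K) {u : G.Node} (hu : 0 < G.degree u) :
    0 ≤ G.connectProb γ α g u := by
  have h0 := bias_nonneg hγ0 hγ1 hα0 hα1
  have h1 := bias_le_one hγ0 hα0 hα1
  rw [connectProb_eq hγ0 hγ1 hα0 hα1 G g hu]
  refine mul_nonneg (Nat.cast_nonneg _) (div_nonneg ?_ (Nat.cast_nonneg _))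
  split_ifs
  · positivity
  · linarith

theorem sum_connectProb {γ α : ℝ} (hγ0 : 0 < γ) (hγ1 : γ ≤ 1) (hα0 : 0 < α) (hα1 : α ≤ 1)
    {G : Network K n₀} (hG : ∀ u, 0 < G.degree u) {g : Fin K} (hg : 0 < G.sameDegree g) :
    ∑ u : G.Node, G.connectProb γ α g u = 1 := by
  have hS : (0 : ℝ) < G.sameDegree g := by exact_mod_cast hg
  have hadd : (G.totalDegree : ℝ) = G.sameDegree g + G.otherDegree g := by
    exact_mod_cast (G.sameDegree_add_otherDegree g).symm
  have hT : (0 : ℝ) < G.totalDegree := by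
    rw [hadd]; exact add_pos_of_pos_of_nonneg hS (Nat.cast_nonneg _)
  simp only [connectProb_eq hγ0 hγ1 hα0 hα1 G g (hG _), ite_div]
  rw [sum_ite_group_degree]
  field_simp
  rw [hadd]
  ring

theorem sum_pickProb {G : Network K n₀} (hT : 0 < G.totalDegree) :
    ∑ u : G.Node, G.pickProb u = 1 := by
  have hT' : (G.totalDegree : ℝ) ≠ 0 := by exact_mod_cast hT.ne'
  simp only [pickProb]
  rw [← Finset.sum_div, ← Nat.cast_sum, ← totalDegree, div_self hT']

theorem pickProb_nonneg (G : Network K n₀) (u : G.Node) : 0 ≤ G.pickProb u :=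
  div_nonneg (Nat.cast_nonneg _) (Nat.cast_nonneg _)

theorem sum_pickProb_mul_group (G : Network K n₀) (φ : Fin K → ℝ) :
    ∑ w : G.Node, G.pickProb w * φ (G.group w) =
      ∑ g : Fin K, (G.sameDegree g : ℝ) / G.totalDegree * φ g := by
  rw [← Finset.sum_fiberwise (s := Finset.univ) (g := G.group)]
  refine Finset.sum_congr rfl fun g _ => ?_
  rw [sameDegree, Nat.cast_sum, Finset.sum_div, Finset.sum_mul]
  refine Finset.sum_congr rfl fun u hu => ?_
  rw [(Finset.mem_filter.1 hu).2, pickProb]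

/-- The probability that the second endpoint of the next edge is `v`. -/
theorem second_endpoint_prob {γ α : ℝ} (hγ0 : 0 < γ) (hγ1 : γ ≤ 1) (hα0 : 0 < α) (hα1 : α ≤ 1)
    (q : ℝ) {p : Fin K → ℝ} (hp1 : ∑ k, p k = 1) {G : Network K n₀} {v : G.Node}
    (hv : 0 < G.degree v) :
    q * ∑ g : Fin K, p g * G.connectProb γ α g v +
        (1 - q) * ∑ w : G.Node, G.pickProb w * G.connectProb γ α (G.group w) v =
      (G.degree v : ℝ) * (1 / G.totalDegree + bias γ α * q *
        (p (G.group v) / G.sameDegree (G.group v) - 1 / G.totalDegree)) := by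
  have hS : (0 : ℝ) < G.sameDegree (G.group v) := by
    exact_mod_cast hv.trans_le (G.degree_le_sameDegree v)
  have hadd : (G.totalDegree : ℝ) = G.sameDegree (G.group v) + G.otherDegree (G.group v) := by
    exact_mod_cast (G.sameDegree_add_otherDegree _).symm
  have hT : (0 : ℝ) < G.totalDegree := by
    rw [hadd]; exact add_pos_of_pos_of_nonneg hS (Nat.cast_nonneg _)
  -- As a function of `g` this is a constant plus a point mass at the group of `v`. An average over
  -- `g` therefore sees only the weight of that group: `p` for a new node, the degree share for an
  -- old one.
  have hconn : ∀ g, G.connectProb γ α g v = (G.degree v : ℝ) / G.totalDegree * (1 - bias γ α) +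
      if G.group v = g then (G.degree v : ℝ) * bias γ α / G.sameDegree (G.group v) else 0 := by
    intro g
    rw [connectProb_eq hγ0 hγ1 hα0 hα1 G g hv]
    split_ifs with hg
    · subst hg
      field_simp
      rw [hadd]
      ring
    · ring
  have hx : ∀ r : Fin K → ℝ, ∑ g, r g = 1 → ∑ g, r g * G.connectProb γ α g v =
      (G.degree v : ℝ) / G.totalDegree * (1 - bias γ α) +
        r (G.group v) * ((G.degree v : ℝ) * bias γ α / G.sameDegree (G.group v)) := by
    intro r hr
    simp only [hconn, mul_add, Finset.sum_add_distrib, ← Finset.sum_mul, hr, one_mul, mul_ite,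
      mul_zero, Finset.sum_ite_eq, Finset.mem_univ, if_true]
  have hshare : ∑ g : Fin K, (G.sameDegree g : ℝ) / G.totalDegree = 1 := by
    have h := G.sum_pickProb_mul_group (fun _ => 1)
    simp only [mul_one] at h
    rw [← h, sum_pickProb (by exact_mod_cast hT)]
  rw [hx p hp1, G.sum_pickProb_mul_group (fun g => G.connectProb γ α g v), hx _ hshare]
  field_simp
  ring

end Network

/-! ### One-step means and the finite set of reachable networks -/

namespace Network

variable {K n₀ : ℕ}

instance : MeasurableSingletonClass (Network K n₀) := ⟨fun _ => trivial⟩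

instance : Countable (Network K n₀) := by
  let F : Network K n₀ → Σ a : ℕ, (Fin (n₀ + a) → Fin K) × List (Fin (n₀ + a) × Fin (n₀ + a)) :=
    fun G => ⟨G.added, G.group, G.edges⟩
  refine Function.Injective.countable (f := F) ?_
  rintro ⟨a, g, e⟩ ⟨a', g', e'⟩ h
  obtain ⟨rfl, h⟩ := Sigma.mk.inj h
  obtain ⟨rfl, rfl⟩ := Prod.mk.inj (eq_of_heq h)
  rfl

/-- The mean of `f` after one step from `G`. -/
noncomputable def stepMean (q : ℝ) (p : Fin K → ℝ) (γ α : ℝ) (f : Network K n₀ → ℝ)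
    (G : Network K n₀) : ℝ :=
  q * (∑ g : Fin K, ∑ u : G.Node, p g * G.connectProb γ α g u * f (G.addNode g u)) +
    (1 - q) * (∑ w : G.Node, ∑ u : G.Node,
      G.pickProb w * G.connectProb γ α (G.group w) u * f (G.addEdge w u))

open Classical in
/-- The networks that can arise from `G` in one step. -/
noncomputable def successors (G : Network K n₀) : Finset (Network K n₀) :=
  Finset.univ.image (fun x : Fin K × G.Node => G.addNode x.1 x.2) ∪
    Finset.univ.image (fun x : G.Node × G.Node => G.addEdge x.1 x.2)

theorem addNode_mem_successors (G : Network K n₀) (g : Fin K) (u : G.Node) :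
    G.addNode g u ∈ G.successors := by
  classical
  exact Finset.mem_union_left _ (Finset.mem_image.2 ⟨(g, u), Finset.mem_univ _, rfl⟩)

theorem addEdge_mem_successors (G : Network K n₀) (w u : G.Node) :
    G.addEdge w u ∈ G.successors := by
  classical
  exact Finset.mem_union_right _ (Finset.mem_image.2 ⟨(w, u), Finset.mem_univ _, rfl⟩)

open Classical in
/-- The networks that can arise from the initial one in `t` steps. -/
noncomputable def reachable (σ : Fin n₀ → Fin K) : ℕ → Finset (Network K n₀)
  | 0 => {initial σ}
  | t + 1 => (reachable σ t).biUnion successors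

theorem successors_subset_reachable (σ : Fin n₀ → Fin K) {t : ℕ} {G : Network K n₀}
    (hG : G ∈ reachable σ t) : G.successors ⊆ reachable σ (t + 1) := by
  classical
  exact Finset.subset_biUnion_of_mem successors hG

theorem sum_stepProb_mul (q : ℝ) (p : Fin K → ℝ) (γ α : ℝ) (f : Network K n₀ → ℝ)
    {G : Network K n₀} {s : Finset (Network K n₀)} (hs : G.successors ⊆ s) :
    ∑ G' ∈ s, stepProb q p γ α G G' * f G' = stepMean q p γ α f G := by
  classical
  have h : ∀ G', stepProb q p γ α G G' * f G' =
      q * (∑ g : Fin K, ∑ u : G.Node,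
        if G' = G.addNode g u then p g * G.connectProb γ α g u * f G' else 0) +
      (1 - q) * (∑ w : G.Node, ∑ u : G.Node, if G' = G.addEdge w u then
        G.pickProb w * G.connectProb γ α (G.group w) u * f G' else 0) := fun G' => by
    rw [stepProb, add_mul, mul_assoc, mul_assoc]
    simp only [Finset.sum_mul, ite_mul, zero_mul]
  rw [Finset.sum_congr rfl fun G' _ => h G', Finset.sum_add_distrib, ← Finset.mul_sum,
    ← Finset.mul_sum, stepMean]
  congr 2
  · rw [Finset.sum_comm]
    refine Finset.sum_congr rfl fun g _ => ?_
    rw [Finset.sum_comm]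
    refine Finset.sum_congr rfl fun u _ => ?_
    rw [Finset.sum_ite_eq', if_pos (hs (G.addNode_mem_successors g u))]
  · rw [Finset.sum_comm]
    refine Finset.sum_congr rfl fun w _ => ?_
    rw [Finset.sum_comm]
    refine Finset.sum_congr rfl fun u _ => ?_
    rw [Finset.sum_ite_eq', if_pos (hs (G.addEdge_mem_successors w u))]

/-- Groups of weight zero receive no new node; this is what preserves `weight_pos` along the chain.
-/
theorem exists_of_stepProb_ne_zero {q : ℝ} {p : Fin K → ℝ} (hp0 : ∀ k, 0 ≤ p k) {γ α : ℝ}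
    {G G' : Network K n₀} (h : stepProb q p γ α G G' ≠ 0) :
    (∃ g u, 0 < p g ∧ G' = G.addNode g u) ∨ ∃ w u, G' = G.addEdge w u := by
  classical
  by_contra! hc
  refine h ?_
  have h1 : ∀ g : Fin K, ∀ u : G.Node,
      (if G' = G.addNode g u then p g * G.connectProb γ α g u else 0) = 0 := fun g u => by
    rcases (hp0 g).eq_or_lt with hg | hg
    · simp [← hg]
    · rw [if_neg (hc.1 g u hg)]
  have h2 : ∀ w u : G.Node,
      (if G' = G.addEdge w u then G.pickProb w * G.connectProb γ α (G.group w) u else 0) = 0 :=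
    fun w u => if_neg (hc.2 w u)
  simp [stepProb, h1, h2]

end Network

/-! ### From probabilities of histories to a recursion for expectations -/

namespace IsKPAProcess

open Network

variable {Ω : Type*} [MeasurableSpace Ω] {P : Measure Ω} [IsProbabilityMeasure P] {K n₀ : ℕ}
  {q : ℝ} {p : Fin K → ℝ} {γ α : ℝ} {σ : Fin n₀ → Fin K} {G : ℕ → Ω → Network K n₀}

/-- There are only countably many histories up to time `t`, so those of probability zero have a null
union. Hence almost every path makes only transitions with nonzero `stepProb`, and structural
properties can be proved pathwise by induction. -/
theorem ae_history_ne_zero (P : Measure Ω) [IsProbabilityMeasure P]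
    (G : ℕ → Ω → Network K n₀) :
    ∀ᵐ ω ∂P, ∀ t, P.real {ω' | ∀ s ≤ t, G s ω' = G s ω} ≠ 0 := by
  rw [ae_all_iff]
  intro t
  let H : Ω → Fin (t + 1) → Network K n₀ := fun ω s => G s ω
  have hH : ∀ ω, {ω' | ∀ s ≤ t, G s ω' = G s ω} = H ⁻¹' {H ω} := fun ω => by
    ext ω'
    simp only [Set.mem_ofPred_eq, Set.mem_preimage, Set.mem_singleton_iff, funext_iff, H]
    exact ⟨fun h s => h s (Nat.lt_succ_iff.1 s.2), fun h s hs => h ⟨s, Nat.lt_succ_iff.2 hs⟩⟩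
  have hnull : P (⋃ h ∈ {h | P (H ⁻¹' {h}) = 0}, H ⁻¹' {h}) = 0 :=
    (measure_biUnion_null_iff (Set.to_countable _)).2 fun h hh => hh
  refine measure_mono_null (fun ω hω => ?_) hnull
  have hω' : P.real (H ⁻¹' {H ω}) = 0 := by rw [← hH]; exact not_not.1 hω
  exact Set.mem_biUnion (x := H ω) ((measureReal_eq_zero_iff).1 hω') rfl

theorem ae_reachable (hn₀ : 0 < n₀) (hp0 : ∀ k, 0 ≤ p k)
    (hσ : ∀ k, (((Finset.univ.filter (fun i => σ i = k)).card : ℕ) : ℝ) = p k * (n₀ : ℝ))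
    (hG : IsKPAProcess P q p γ α σ G) :
    ∀ᵐ ω ∂P, ∀ t, G t ω ∈ reachable σ t ∧ (G t ω).Admissible p t := by
  filter_upwards [hG.start, ae_history_ne_zero P G] with ω h0 hω t
  induction t with
  | zero => rw [h0]; exact ⟨by simp [reachable], Admissible.initial hn₀ σ hσ⟩
  | succ t ih =>
    have hstep := hω (t + 1)
    rw [hG.step t (fun s => G s ω)] at hstep
    rcases exists_of_stepProb_ne_zero hp0 (right_ne_zero_of_mul hstep) with
      ⟨g, u, hg, h⟩ | ⟨w, u, h⟩
    · rw [h]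
      exact ⟨successors_subset_reachable σ ih.1 (addNode_mem_successors _ g u),
        ih.2.addNode hg u⟩
    · rw [h]
      exact ⟨successors_subset_reachable σ ih.1 (addEdge_mem_successors _ w u),
        ih.2.addEdge w u⟩

/-- The field `step` speaks of whole histories; summing it over the finitely many reachable
histories that end in `a` leaves a statement about two consecutive times. -/
theorem measureReal_eq_and_eq (hG : IsKPAProcess P q p γ α σ G)
    (hr : ∀ᵐ ω ∂P, ∀ t, G t ω ∈ reachable σ t) (t : ℕ) (a b : Network K n₀) :
    P.real {ω | G t ω = a ∧ G (t + 1) ω = b} =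
      P.real {ω | G t ω = a} * stepProb q p γ α a b := by
  classical
  let H : Ω → Fin (t + 1) → Network K n₀ := fun ω s => G s ω
  have hHm : Measurable H := measurable_pi_lambda _ fun s => hG.measurable s
  let s := (Fintype.piFinset fun i : Fin (t + 1) => reachable σ i).filter
    fun h => h (Fin.last t) = a
  have hB : {ω | G t ω = a} =ᵐ[P] H ⁻¹' s := by
    filter_upwards [hr] with ω hω
    refine propext (?_ : G t ω = a ↔ H ω ∈ (s : Set _))
    simp [s, H, hω]
  have hC : MeasurableSet {ω | G (t + 1) ω = b} :=
    hG.measurable (t + 1) (measurableSet_singleton b)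
  have hA : {ω | G t ω = a ∧ G (t + 1) ω = b} =ᵐ[P] (H ⁻¹' s ∩ {ω | G (t + 1) ω = b} : Set Ω) :=
    hB.inter (ae_eq_refl {ω | G (t + 1) ω = b})
  have hsm : ∀ h ∈ s, MeasurableSet (H ⁻¹' {h}) := fun h _ => hHm (measurableSet_singleton h)
  rw [measureReal_congr hB, measureReal_congr hA, ← sum_measureReal_preimage_singleton s hsm,
    ← measureReal_restrict_apply (hHm s.measurableSet), ← sum_measureReal_preimage_singleton s hsm,
    Finset.sum_mul]
  refine Finset.sum_congr rfl fun h hh => ?_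
  rw [measureReal_restrict_apply (hsm h hh)]
  -- The finite history is continued by the constant `b`, because `step` takes functions on all of
  -- `ℕ`.
  let h' : ℕ → Network K n₀ := fun n => if hn : n < t + 1 then h ⟨n, hn⟩ else b
  have h1 : H ⁻¹' {h} = {ω | ∀ n ≤ t, G n ω = h' n} := by
    ext ω
    simp only [Set.mem_ofPred_eq, Set.mem_preimage, Set.mem_singleton_iff, funext_iff, H, h']
    refine ⟨fun hω n hn => ?_, fun hω n => ?_⟩
    · rw [dif_pos (Nat.lt_succ_iff.2 hn)]; exact hω ⟨n, _⟩
    · rw [hω n (Nat.lt_succ_iff.1 n.2), dif_pos n.2]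
  have h2 : H ⁻¹' {h} ∩ {ω | G (t + 1) ω = b} = {ω | ∀ n ≤ t + 1, G n ω = h' n} := by
    rw [h1]
    ext ω
    have hb : h' (t + 1) = b := dif_neg (lt_irrefl _)
    simp only [Set.mem_inter_iff, Set.mem_ofPred_eq]
    refine ⟨fun hω n hn => ?_, fun hω => ⟨fun n hn => hω n (hn.trans t.le_succ), ?_⟩⟩
    · rcases Nat.le_succ_iff.1 hn with hn | rfl
      · exact hω.1 n hn
      · rw [hb]; exact hω.2
    · rw [hω _ le_rfl, hb]
  have h3 : h' t = a := by
    simp only [h', dif_pos (Nat.lt_succ_self t)]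
    exact (Finset.mem_filter.1 hh).2
  have h4 : h' (t + 1) = b := dif_neg (lt_irrefl _)
  rw [h2, hG.step t h', ← h1, h3, h4]

theorem integrable_comp (hG : IsKPAProcess P q p γ α σ G)
    (hr : ∀ᵐ ω ∂P, ∀ t, G t ω ∈ reachable σ t) (t : ℕ) (f : Network K n₀ → ℝ) :
    Integrable (fun ω => f (G t ω)) P := by
  refine Integrable.of_bound (C := ∑ a ∈ reachable σ t, ‖f a‖)
    ((measurable_from_top (f := f)).comp (hG.measurable t)).aestronglyMeasurable ?_
  filter_upwards [hr] with ω hω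
  exact Finset.single_le_sum (f := fun a => ‖f a‖) (fun _ _ => norm_nonneg _) (hω t)

theorem integral_comp (hG : IsKPAProcess P q p γ α σ G)
    (hr : ∀ᵐ ω ∂P, ∀ t, G t ω ∈ reachable σ t) (t : ℕ) (f : Network K n₀ → ℝ) :
    ∫ ω, f (G t ω) ∂P = ∑ a ∈ reachable σ t, P.real {ω | G t ω = a} * f a := by
  classical
  have h : (fun ω => f (G t ω)) =ᵐ[P]
      fun ω => ∑ a ∈ reachable σ t, Set.indicator {ω | G t ω = a} (fun _ => f a) ω := by
    filter_upwards [hr] with ω hω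
    simp [Set.indicator_apply, hω t]
  have hm : ∀ a, MeasurableSet {ω | G t ω = a} :=
    fun a => hG.measurable t (measurableSet_singleton a)
  rw [integral_congr_ae h, integral_finsetSum _ fun a _ =>
    (integrable_const (f a)).indicator (hm a)]
  refine Finset.sum_congr rfl fun a _ => ?_
  rw [integral_indicator_const _ (hm a), smul_eq_mul]

theorem integral_succ (hG : IsKPAProcess P q p γ α σ G)
    (hr : ∀ᵐ ω ∂P, ∀ t, G t ω ∈ reachable σ t) (t : ℕ) (f : Network K n₀ → ℝ) :
    ∫ ω, f (G (t + 1) ω) ∂P = ∫ ω, stepMean q p γ α f (G t ω) ∂P := by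
  classical
  have hm : ∀ t a, MeasurableSet {ω | G t ω = a} :=
    fun t a => hG.measurable t (measurableSet_singleton a)
  have hlaw : ∀ b, P.real {ω | G (t + 1) ω = b} =
      ∑ a ∈ reachable σ t, P.real {ω | G t ω = a} * stepProb q p γ α a b := fun b => by
    have hE : {ω | G (t + 1) ω = b} =ᵐ[P]
        (G t ⁻¹' (reachable σ t : Set (Network K n₀)) ∩ {ω | G (t + 1) ω = b} : Set Ω) := by
      filter_upwards [hr] with ω hω
      exact propext ⟨fun h => ⟨hω t, h⟩, fun h => h.2⟩
    rw [measureReal_congr hE, ← measureReal_restrict_apply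
      (hG.measurable t (Finset.measurableSet _)), ← sum_measureReal_preimage_singleton _
      fun a _ => hm t a]
    refine Finset.sum_congr rfl fun a _ => ?_
    rw [← measureReal_eq_and_eq hG hr]
    exact measureReal_restrict_apply (hm t a)
  rw [integral_comp hG hr, integral_comp hG hr]
  simp only [hlaw, Finset.sum_mul]
  rw [Finset.sum_comm]
  refine Finset.sum_congr rfl fun a ha => ?_
  rw [← sum_stepProb_mul q p γ α f (successors_subset_reachable σ ha), Finset.mul_sum]
  exact Finset.sum_congr rfl fun b _ => mul_assoc _ _ _

end IsKPAProcess

/-! ### One-step means of the excess and of the degree counts -/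

namespace Network

variable {K n₀ : ℕ}

theorem Admissible.totalDegree_pos {p : Fin K → ℝ} {t : ℕ} {G : Network K n₀} (hn₀ : 0 < n₀)
    (hG : G.Admissible p t) : 0 < G.totalDegree := by
  rw [hG.totalDegree_eq]; omega

theorem stepMean_mono {q : ℝ} (hq0 : 0 ≤ q) (hq1 : q ≤ 1) {p : Fin K → ℝ} (hp0 : ∀ k, 0 ≤ p k)
    {γ α : ℝ} (hγ0 : 0 < γ) (hγ1 : γ ≤ 1) (hα0 : 0 < α) (hα1 : α ≤ 1) {t : ℕ} {G : Network K n₀}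
    (hG : G.Admissible p t) {f h : Network K n₀ → ℝ}
    (hn : ∀ g u, f (G.addNode g u) ≤ h (G.addNode g u))
    (he : ∀ w u, f (G.addEdge w u) ≤ h (G.addEdge w u)) :
    stepMean q p γ α f G ≤ stepMean q p γ α h G := by
  have hc : ∀ g u, 0 ≤ G.connectProb γ α g u :=
    fun g u => connectProb_nonneg hγ0 hγ1 hα0 hα1 G g (hG.degree_pos u)
  refine add_le_add (mul_le_mul_of_nonneg_left ?_ hq0)
    (mul_le_mul_of_nonneg_left ?_ (sub_nonneg.2 hq1))
  · exact Finset.sum_le_sum fun g _ => Finset.sum_le_sum fun u _ =>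
      mul_le_mul_of_nonneg_left (hn g u) (mul_nonneg (hp0 g) (hc g u))
  · exact Finset.sum_le_sum fun w _ => Finset.sum_le_sum fun u _ =>
      mul_le_mul_of_nonneg_left (he w u) (mul_nonneg (G.pickProb_nonneg w) (hc _ u))

/-- The mean over one step of a function that is, up to a correction `r` in edge-steps, the sum of
contributions of the two endpoints of the new edge. -/
theorem stepMean_of_endpoints (hn₀ : 0 < n₀) {p : Fin K → ℝ} (hp0 : ∀ k, 0 ≤ p k)
    (hp1 : ∑ k, p k = 1) {γ α : ℝ} (hγ0 : 0 < γ) (hγ1 : γ ≤ 1) (hα0 : 0 < α) (hα1 : α ≤ 1)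
    (q : ℝ) {t : ℕ} {G : Network K n₀} (hG : G.Admissible p t) (f : Network K n₀ → ℝ) (c : ℝ)
    (a : Fin K → ℝ) (a' b : G.Node → ℝ) (r : G.Node → G.Node → ℝ)
    (hn : ∀ g u, f (G.addNode g u) = c + a g + b u)
    (he : ∀ w u, f (G.addEdge w u) = c + a' w + b u + r w u) :
    stepMean q p γ α f G =
      c + q * ∑ g, p g * a g + (1 - q) * ∑ w, G.pickProb w * a' w +
        ∑ u, (G.degree u : ℝ) * (1 / G.totalDegree + bias γ α * q *
          (p (G.group u) / G.sameDegree (G.group u) - 1 / G.totalDegree)) * b u +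
        (1 - q) * ∑ w, ∑ u, G.pickProb w * G.connectProb γ α (G.group w) u * r w u := by
  have hs : ∀ g, 0 < p g → ∑ u, G.connectProb γ α g u = 1 :=
    fun g hg => sum_connectProb hγ0 hγ1 hα0 hα1 hG.degree_pos (hG.sameDegree_pos hg)
  -- A group of weight zero may be empty, and then its connection probabilities need not sum to one;
  -- its term vanishes through the factor `p g`.
  have hN : ∀ g, ∑ u, p g * G.connectProb γ α g u * (c + a g + b u) =
      p g * (c + a g) + ∑ u, p g * G.connectProb γ α g u * b u := fun g => by
    rcases (hp0 g).eq_or_lt with hg | hg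
    · simp [← hg]
    · simp only [mul_add _ _ (b _), Finset.sum_add_distrib, ← Finset.sum_mul, ← Finset.mul_sum,
        hs g hg, mul_one]
  have hE : ∀ w, ∑ u, G.pickProb w * G.connectProb γ α (G.group w) u * (c + a' w + b u + r w u) =
      G.pickProb w * (c + a' w) + ∑ u, G.pickProb w * G.connectProb γ α (G.group w) u * b u +
        ∑ u, G.pickProb w * G.connectProb γ α (G.group w) u * r w u := fun w => by
    simp only [mul_add _ _ (b _), mul_add _ _ (r _ _), Finset.sum_add_distrib, ← Finset.sum_mul,
      ← Finset.mul_sum, hs _ (hG.weight_pos w), mul_one]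
  have hb : ∑ u, (G.degree u : ℝ) * (1 / G.totalDegree + bias γ α * q *
        (p (G.group u) / G.sameDegree (G.group u) - 1 / G.totalDegree)) * b u =
      q * ∑ g, ∑ u, p g * G.connectProb γ α g u * b u +
        (1 - q) * ∑ w, ∑ u, G.pickProb w * G.connectProb γ α (G.group w) u * b u := by
    have hc1 : ∑ g, ∑ u, p g * G.connectProb γ α g u * b u =
        ∑ u, ∑ g, p g * G.connectProb γ α g u * b u := Finset.sum_comm
    have hc2 : ∑ w, ∑ u, G.pickProb w * G.connectProb γ α (G.group w) u * b u =
        ∑ u, ∑ w, G.pickProb w * G.connectProb γ α (G.group w) u * b u := Finset.sum_comm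
    rw [hc1, hc2, Finset.mul_sum, Finset.mul_sum, ← Finset.sum_add_distrib]
    refine Finset.sum_congr rfl fun u _ => ?_
    rw [← second_endpoint_prob hγ0 hγ1 hα0 hα1 q hp1 (hG.degree_pos u), ← Finset.sum_mul,
      ← Finset.sum_mul]
    ring
  have hpc : ∑ g, p g * c = c := by rw [← Finset.sum_mul, hp1, one_mul]
  have hkc : ∑ w, G.pickProb w * c = c := by
    rw [← Finset.sum_mul, sum_pickProb (hG.totalDegree_pos hn₀), one_mul]
  rw [hb]
  simp only [stepMean, hn, he]
  simp only [hN, hE]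
  simp only [Finset.sum_add_distrib, mul_add, hpc, hkc]
  ring

section Share

variable {q : ℝ} {p : Fin K → ℝ} {γ α : ℝ} {t : ℕ} {G : Network K n₀}

/-- The excess of the degree sum of group `k` over its share `p k` of all degrees. -/
noncomputable def excess (p : Fin K → ℝ) (k : Fin K) (G : Network K n₀) : ℝ :=
  G.sameDegree k - p k * G.totalDegree

/-- The mean increment of `y` is `(2 - q - bias * q) * y / T`: the two endpoints contribute `(1 - q)
* y / T` and `(1 - bias * q) * y / T`. Doubling it for the square gives the factor `4 - 2 * q` once
the nonpositive bias term is dropped. -/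
theorem stepMean_excess_sq_le (hn₀ : 0 < n₀) (hq0 : 0 ≤ q) (hq1 : q ≤ 1) (hp0 : ∀ k, 0 ≤ p k)
    (hp1 : ∑ k, p k = 1) (hγ0 : 0 < γ) (hγ1 : γ ≤ 1) (hα0 : 0 < α) (hα1 : α ≤ 1)
    (hG : G.Admissible p t) (k : Fin K) :
    stepMean q p γ α (fun G' => excess p k G' ^ 2) G ≤
      (1 + (4 - 2 * q) / (n₀ + 2 * t)) * excess p k G ^ 2 + 4 := by
  have hTpos : (0 : ℝ) < G.totalDegree := by exact_mod_cast hG.totalDegree_pos hn₀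
  have hTt : (G.totalDegree : ℝ) = n₀ + 2 * t := by rw [hG.totalDegree_eq]; push_cast; ring
  have hpk : p k ≤ 1 := hp1 ▸ Finset.single_le_sum (fun i _ => hp0 i) (Finset.mem_univ k)
  have hpk0 := hp0 k
  set y := excess p k G with hy
  -- The increment of `y` is at most 2 in absolute value, so its square is bounded by 4. What
  -- remains is affine in the degree sum, hence additive over the two endpoints with no loop
  -- correction.
  let h : Network K n₀ → ℝ := fun G' =>
    y ^ 2 + 4 + 2 * y * ((G'.sameDegree k : ℝ) - G.sameDegree k - 2 * p k)
  have hsq : ∀ D : ℝ, 0 ≤ D → D ≤ 2 →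
      (y + (D - 2 * p k)) ^ 2 ≤ y ^ 2 + 4 + 2 * y * (D - 2 * p k) := fun D h0 h2 => by
    have : (D - 2 * p k) ^ 2 ≤ 2 ^ 2 := sq_le_sq' (by linarith) (by linarith)
    nlinarith
  have hite : ∀ (P Q : Prop) [Decidable P] [Decidable Q],
      (0 : ℝ) ≤ (if P then 1 else 0) + (if Q then 1 else 0) ∧
      (if P then 1 else 0) + (if Q then 1 else 0) ≤ (2 : ℝ) := by
    intro P Q _ _
    constructor <;> split_ifs <;> norm_num
  have hSN : ∀ g u, ((G.addNode g u).sameDegree k : ℝ) = G.sameDegree k +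
      ((if g = k then 1 else 0) + if G.group u = k then 1 else 0) := fun g u => by
    rw [sameDegree_addNode]; push_cast; rfl
  have hSE : ∀ w u, ((G.addEdge w u).sameDegree k : ℝ) = G.sameDegree k +
      ((if G.group w = k then 1 else 0) + if G.group u = k then 1 else 0) := fun w u => by
    rw [sameDegree_addEdge]; push_cast; rfl
  have hle : stepMean q p γ α (fun G' => excess p k G' ^ 2) G ≤ stepMean q p γ α h G := by
    refine stepMean_mono hq0 hq1 hp0 hγ0 hγ1 hα0 hα1 hG (fun g u => ?_) (fun w u => ?_)
    · have := hsq _ (hite (g = k) (G.group u = k)).1 (hite (g = k) (G.group u = k)).2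
      simp only [h, excess, hSN, totalDegree_addNode]
      push_cast
      rw [hy, excess] at this ⊢
      convert this using 2 <;> ring
    · have := hsq _ (hite (G.group w = k) (G.group u = k)).1
        (hite (G.group w = k) (G.group u = k)).2
      simp only [h, excess, hSE, totalDegree_addEdge]
      push_cast
      rw [hy, excess] at this ⊢
      convert this using 2 <;> ring
  refine hle.trans ?_
  rw [stepMean_of_endpoints hn₀ hp0 hp1 hγ0 hγ1 hα0 hα1 q hG h (y ^ 2 + 4 - 4 * y * p k)
    (fun g => if g = k then 2 * y else 0) (fun w => if G.group w = k then 2 * y else 0)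
    (fun u => if G.group u = k then 2 * y else 0) (fun _ _ => 0)
    (fun g u => by simp only [h, hSN]; split_ifs <;> ring)
    (fun w u => by simp only [h, hSE]; split_ifs <;> ring)]
  have h1 : ∑ g, p g * (if g = k then 2 * y else 0) = p k * (2 * y) := by simp
  have h2 : ∑ w, G.pickProb w * (if G.group w = k then 2 * y else 0) =
      G.sameDegree k / G.totalDegree * (2 * y) := by
    simpa using G.sum_pickProb_mul_group (fun g => if g = k then 2 * y else 0)
  have h3 : ∑ u, (G.degree u : ℝ) * (1 / G.totalDegree + bias γ α * q *
        (p (G.group u) / G.sameDegree (G.group u) - 1 / G.totalDegree)) *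
          (if G.group u = k then 2 * y else 0) =
      G.sameDegree k * ((1 / G.totalDegree + bias γ α * q *
        (p k / G.sameDegree k - 1 / G.totalDegree)) * (2 * y)) := by
    have := G.sum_ite_group_degree k ((1 / G.totalDegree + bias γ α * q *
        (p k / G.sameDegree k - 1 / G.totalDegree)) * (2 * y)) 0
    rw [mul_zero, add_zero] at this
    rw [← this]
    refine Finset.sum_congr rfl fun u _ => ?_
    split_ifs with hu
    · rw [hu]; ring
    · ring
  have h4 : (G.sameDegree k : ℝ) * (p k / G.sameDegree k) = p k := by
    rcases hpk0.eq_or_lt with hk | hk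
    · simp [← hk]
    · have : (G.sameDegree k : ℝ) ≠ 0 := by exact_mod_cast (hG.sameDegree_pos hk).ne'
      field_simp
  have h5 : (G.sameDegree k : ℝ) = y + p k * G.totalDegree := by rw [hy, excess]; ring
  have h6 : (G.sameDegree k : ℝ) / G.totalDegree = y / G.totalDegree + p k := by
    rw [h5]; field_simp
  have h3' : (G.sameDegree k : ℝ) * ((1 / G.totalDegree + bias γ α * q *
        (p k / G.sameDegree k - 1 / G.totalDegree)) * (2 * y)) =
      (y / G.totalDegree + p k - bias γ α * q * (y / G.totalDegree)) * (2 * y) := by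
    calc _ = (G.sameDegree k / G.totalDegree + bias γ α * q *
        (G.sameDegree k * (p k / G.sameDegree k) - G.sameDegree k / G.totalDegree)) * (2 * y) := by
          ring
      _ = _ := by rw [h4, h6]; ring
  rw [h1, h2, h3, h3', h6, ← hTt]
  simp only [mul_zero, Finset.sum_const_zero, add_zero]
  -- The preference for the own group pulls the share back towards `p k`, so its contribution has a
  -- favourable sign.
  have h7 : 0 ≤ bias γ α * q * (y ^ 2 / G.totalDegree) :=
    mul_nonneg (mul_nonneg (bias_nonneg hγ0 hγ1 hα0 hα1) hq0) (by positivity)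
  have h8 : (1 + (4 - 2 * q) / G.totalDegree) * y ^ 2 + 4 -
      (y ^ 2 + 4 - 4 * y * p k + q * (p k * (2 * y)) +
        (1 - q) * ((y / G.totalDegree + p k) * (2 * y)) +
        (y / G.totalDegree + p k - bias γ α * q * (y / G.totalDegree)) * (2 * y)) =
      2 * (bias γ α * q * (y ^ 2 / G.totalDegree)) := by ring
  linarith

theorem countDegree_addNode (G : Network K n₀) (k : Fin K) (d : ℕ) (g : Fin K) (u : G.Node) :
    ((G.addNode g u).countDegree k d : ℝ) =
      G.countDegree k d + (if g = k ∧ 1 = d then 1 else 0) +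
        if G.group u = k then
          (if G.degree u + 1 = d then 1 else 0) - (if G.degree u = d then 1 else 0) else 0 := by
  have h : ∀ v : G.Node,
      (if G.group v = k ∧ (G.degree v + if u = v then 1 else 0) = d then (1 : ℝ) else 0) =
      (if G.group v = k ∧ G.degree v = d then 1 else 0) + if u = v then
        (if G.group u = k then
          (if G.degree u + 1 = d then 1 else 0) - (if G.degree u = d then 1 else 0) else 0)
        else 0 := fun v => by
    by_cases huv : u = v
    · subst huv
      by_cases hk : G.group u = k <;> simp [hk]
    · simp [huv]
  rw [countDegree_eq_nodeSum, nodeSum_addNode, Finset.sum_congr rfl fun v _ => h v,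
    Finset.sum_add_distrib, countDegree_eq_nodeSum, nodeSum, Finset.sum_ite_eq,
    if_pos (Finset.mem_univ u)]
  ring

/-- The last term is the loop correction: a loop moves a node from degree `n` to `n + 2`, which
differs from two separate moves to `n + 1` by a second difference. -/
theorem countDegree_addEdge (G : Network K n₀) (k : Fin K) (d : ℕ) (w u : G.Node) :
    ((G.addEdge w u).countDegree k d : ℝ) =
      G.countDegree k d +
        (if G.group w = k then
          (if G.degree w + 1 = d then 1 else 0) - (if G.degree w = d then 1 else 0) else 0) +
        (if G.group u = k then
          (if G.degree u + 1 = d then 1 else 0) - (if G.degree u = d then 1 else 0) else 0) +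
        if w = u then
          (if G.group w = k then (if G.degree w + 2 = d then 1 else 0) -
            2 * (if G.degree w + 1 = d then 1 else 0) + (if G.degree w = d then 1 else 0) else 0)
        else 0 := by
  have h : ∀ v : G.Node,
      (if G.group v = k ∧
        (G.degree v + ((if w = v then 1 else 0) + if u = v then 1 else 0)) = d
          then (1 : ℝ) else 0) =
      (if G.group v = k ∧ G.degree v = d then 1 else 0) + (if w = v then
        (if G.group w = k then
          (if G.degree w + 1 = d then 1 else 0) - (if G.degree w = d then 1 else 0) else 0)
        else 0) + (if u = v then
        (if G.group u = k then
          (if G.degree u + 1 = d then 1 else 0) - (if G.degree u = d then 1 else 0) else 0)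
        else 0) + (if w = v then if w = u then
          (if G.group w = k then (if G.degree w + 2 = d then 1 else 0) -
            2 * (if G.degree w + 1 = d then 1 else 0) + (if G.degree w = d then 1 else 0) else 0)
          else 0 else 0) := fun v => by
    by_cases hwv : w = v
    · subst hwv
      by_cases huv : u = w
      · subst huv
        by_cases hk : G.group u = k
        · simp only [hk, true_and, if_true, add_assoc, Nat.reduceAdd]
          split_ifs <;> first | omega | norm_num
        · simp [hk]
      · by_cases hk : G.group w = k <;> simp [hk, huv, Ne.symm huv]
    · by_cases huv : u = v
      · subst huv
        by_cases hk : G.group u = k <;> simp [hk, hwv]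
      · simp [huv, hwv]
  rw [countDegree_eq_nodeSum, nodeSum_addEdge, Finset.sum_congr rfl fun v _ => h v,
    Finset.sum_add_distrib, Finset.sum_add_distrib, Finset.sum_add_distrib,
    countDegree_eq_nodeSum, nodeSum]
  simp only [Finset.sum_ite_eq, Finset.mem_univ, if_true]

theorem sum_degree_mul_shift (G : Network K n₀) (k : Fin K) {d : ℕ} (hd : 1 ≤ d) :
    ∑ u : G.Node, (G.degree u : ℝ) * (if G.group u = k then
        (if G.degree u + 1 = d then 1 else 0) - (if G.degree u = d then 1 else 0) else 0) =
      ((d : ℝ) - 1) * G.countDegree k (d - 1) - d * G.countDegree k d := by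
  simp only [countDegree_eq_nodeSum, nodeSum]
  rw [Finset.mul_sum, Finset.mul_sum, ← Finset.sum_sub_distrib]
  refine Finset.sum_congr rfl fun u _ => ?_
  obtain ⟨e, rfl⟩ : ∃ e, d = e + 1 := ⟨d - 1, by omega⟩
  by_cases hk : G.group u = k
  · by_cases h1 : G.degree u = e
    · simp [hk, h1]
    · by_cases h2 : G.degree u = e + 1 <;> simp [hk, h1, h2]
  · simp [hk]

/-- Two effects separate the mean from pure preferential attachment. The group bias contributes `-(D
/ S) * bias * q * y / T` with `|D| ≤ S` and `bias ≤ 1`; loops contribute the second error term. -/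
theorem abs_stepMean_countDegree_le (hn₀ : 0 < n₀) (hq0 : 0 ≤ q) (hq1 : q ≤ 1)
    (hp0 : ∀ k, 0 ≤ p k) (hp1 : ∑ k, p k = 1) (hγ0 : 0 < γ) (hγ1 : γ ≤ 1) (hα0 : 0 < α)
    (hα1 : α ≤ 1) (hG : G.Admissible p t) (k : Fin K) {d : ℕ} (hd : 1 ≤ d) :
    |stepMean q p γ α (fun G' => (G'.countDegree k d : ℝ)) G -
        (G.countDegree k d + q * p k * (if d = 1 then 1 else 0) +
          (2 - q) / (n₀ + 2 * t) *
            (((d : ℝ) - 1) * G.countDegree k (d - 1) - d * G.countDegree k d))| ≤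
      q * |excess p k G| / (n₀ + 2 * t) + 2 * d / (n₀ + 2 * t) := by
  have hTpos : (0 : ℝ) < G.totalDegree := by exact_mod_cast hG.totalDegree_pos hn₀
  have hTt : (G.totalDegree : ℝ) = n₀ + 2 * t := by rw [hG.totalDegree_eq]; push_cast; ring
  let b : G.Node → ℝ := fun u => if G.group u = k then
    (if G.degree u + 1 = d then 1 else 0) - (if G.degree u = d then 1 else 0) else 0
  let r : G.Node → ℝ := fun w => if G.group w = k then (if G.degree w + 2 = d then 1 else 0) -
    2 * (if G.degree w + 1 = d then 1 else 0) + (if G.degree w = d then 1 else 0) else 0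
  set D : ℝ := ((d : ℝ) - 1) * G.countDegree k (d - 1) - d * G.countDegree k d with hD
  have hbD : ∑ u : G.Node, (G.degree u : ℝ) * b u = D := G.sum_degree_mul_shift k hd
  have hmean := stepMean_of_endpoints hn₀ hp0 hp1 hγ0 hγ1 hα0 hα1 q hG
    (fun G' => (G'.countDegree k d : ℝ)) (G.countDegree k d)
    (fun g => if g = k ∧ 1 = d then 1 else 0) b b (fun w u => if w = u then r w else 0)
    (fun g u => G.countDegree_addNode k d g u) (fun w u => G.countDegree_addEdge k d w u)
  have h1 : ∑ g, p g * (if g = k ∧ 1 = d then 1 else 0) = p k * (if d = 1 then 1 else 0) := by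
    by_cases hd1 : d = 1
    · simp [hd1]
    · simp [hd1, Ne.symm hd1]
  have h2 : ∑ w, G.pickProb w * b w = D / G.totalDegree := by
    rw [← hbD, Finset.sum_div]
    exact Finset.sum_congr rfl fun u _ => by rw [pickProb]; ring
  have h3 : ∑ u, (G.degree u : ℝ) * (1 / G.totalDegree + bias γ α * q *
        (p (G.group u) / G.sameDegree (G.group u) - 1 / G.totalDegree)) * b u =
      D * (1 / G.totalDegree + bias γ α * q * (p k / G.sameDegree k - 1 / G.totalDegree)) := by
    rw [← hbD, Finset.sum_mul]
    refine Finset.sum_congr rfl fun u _ => ?_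
    by_cases hu : G.group u = k
    · rw [hu]; ring
    · simp [b, hu]
  have h4 : ∑ w, ∑ u, G.pickProb w * G.connectProb γ α (G.group w) u *
      (if w = u then r w else 0) =
      ∑ w, G.pickProb w * G.connectProb γ α (G.group w) w * r w :=
    Finset.sum_congr rfl fun w _ => by simp
  have hDS : |D| ≤ G.sameDegree k := by
    have ha : ((d : ℝ) - 1) * G.countDegree k (d - 1) ≤ G.sameDegree k := by
      have := G.mul_countDegree_le_sameDegree k (d - 1)
      rw [← Nat.cast_pred (by omega)]
      exact_mod_cast this
    have hb : (d : ℝ) * G.countDegree k d ≤ G.sameDegree k := by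
      exact_mod_cast G.mul_countDegree_le_sameDegree k d
    have hd' : (1 : ℝ) ≤ d := by exact_mod_cast hd
    have ha0 : 0 ≤ ((d : ℝ) - 1) * G.countDegree k (d - 1) :=
      mul_nonneg (by linarith) (Nat.cast_nonneg _)
    have hb0 : 0 ≤ (d : ℝ) * G.countDegree k d := by positivity
    exact abs_le.2 ⟨by linarith, by linarith⟩
  have hbias : |D * (bias γ α * q * (p k / G.sameDegree k - 1 / G.totalDegree))| ≤
      q * |excess p k G| / G.totalDegree := by
    -- For a group without degree the quotient `p k / S` is meaningless, but the flow `D` vanishes.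
    rcases (Nat.cast_nonneg (α := ℝ) (G.sameDegree k)).eq_or_lt with hS | hS
    · have : D = 0 := abs_nonpos_iff.1 (hDS.trans_eq hS.symm)
      rw [this, zero_mul, abs_zero]
      positivity
    · have he : D * (bias γ α * q * (p k / G.sameDegree k - 1 / G.totalDegree)) =
          (D / G.sameDegree k) * (bias γ α * (-(q * excess p k G / G.totalDegree))) := by
        rw [excess]; field_simp; ring
      have hx : |D / G.sameDegree k| ≤ 1 := by
        rw [abs_div, abs_of_pos hS]; exact div_le_one_of_le₀ hDS hS.le
      have hy : |bias γ α| ≤ 1 := by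
        rw [abs_of_nonneg (bias_nonneg hγ0 hγ1 hα0 hα1)]; exact bias_le_one hγ0 hα0 hα1
      have hz : |(-(q * excess p k G / G.totalDegree))| = q * |excess p k G| / G.totalDegree := by
        rw [abs_neg, abs_div, abs_mul, abs_of_nonneg hq0, abs_of_pos hTpos]
      rw [he, abs_mul, abs_mul, hz]
      have hz0 : 0 ≤ q * |excess p k G| / G.totalDegree := by positivity
      calc _ ≤ 1 * (1 * (q * |excess p k G| / G.totalDegree)) := by gcongr
        _ = _ := by ring
  have hc : ∀ g u, 0 ≤ G.connectProb γ α g u :=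
    fun g u => connectProb_nonneg hγ0 hγ1 hα0 hα1 G g (hG.degree_pos u)
  have hterm : ∀ w, |G.pickProb w * G.connectProb γ α (G.group w) w * r w| ≤
      2 * d / G.totalDegree * if G.group w = k then G.connectProb γ α k w else 0 := fun w => by
    by_cases hw : G.group w = k
    · rw [if_pos hw, hw, abs_mul, abs_mul, abs_of_nonneg (G.pickProb_nonneg w),
        abs_of_nonneg (hc k w)]
      -- The correction vanishes unless the degree is at most `d`, and it never exceeds 2 in
      -- absolute value. Such a node is picked with probability at most `d / T`, whence `2 * d / T`
      -- after summing the connection probabilities.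
      have hr : (G.degree w : ℝ) * |r w| ≤ 2 * d := by
        by_cases hle : G.degree w ≤ d
        · have hr2 : |r w| ≤ 2 := by
            simp only [r, hw, if_true]
            split_ifs <;> first | omega | norm_num
          have : (G.degree w : ℝ) ≤ d := by exact_mod_cast hle
          calc (G.degree w : ℝ) * |r w| ≤ d * 2 := by gcongr
            _ = 2 * d := by ring
        · have : r w = 0 := by
            simp only [r, hw, if_true]
            rw [if_neg (by omega), if_neg (by omega), if_neg (by omega)]
            norm_num
          rw [this, abs_zero, mul_zero]
          positivity
      calc G.pickProb w * G.connectProb γ α k w * |r w|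
          = (G.degree w * |r w|) * (G.connectProb γ α k w / G.totalDegree) := by
            rw [pickProb]; ring
        _ ≤ 2 * d * (G.connectProb γ α k w / G.totalDegree) :=
            mul_le_mul_of_nonneg_right hr (div_nonneg (hc k w) hTpos.le)
        _ = _ := by ring
    · simp [r, hw]
  have hloop : |∑ w, G.pickProb w * G.connectProb γ α (G.group w) w * r w| ≤
      2 * d / G.totalDegree := by
    refine (Finset.abs_sum_le_sum_abs _ _).trans ((Finset.sum_le_sum fun w _ => hterm w).trans ?_)
    rw [← Finset.mul_sum]
    refine mul_le_of_le_one_right (by positivity) ?_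
    rcases (hp0 k).eq_or_lt with hk | hk
    · have : ∀ w, G.group w ≠ k := fun w hw => (hG.weight_pos w).ne' (hw ▸ hk.symm)
      simp [this]
    · rw [← sum_connectProb hγ0 hγ1 hα0 hα1 hG.degree_pos (hG.sameDegree_pos hk)]
      refine Finset.sum_le_sum fun w _ => ?_
      split_ifs
      · exact le_rfl
      · exact hc k w
  rw [hmean, h1, h2, h3, h4, ← hTt]
  have heq : G.countDegree k d + q * (p k * (if d = 1 then 1 else 0)) +
      (1 - q) * (D / G.totalDegree) +
      D * (1 / G.totalDegree + bias γ α * q * (p k / G.sameDegree k - 1 / G.totalDegree)) +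
      (1 - q) * (∑ w, G.pickProb w * G.connectProb γ α (G.group w) w * r w) -
      (G.countDegree k d + q * p k * (if d = 1 then 1 else 0) + (2 - q) / G.totalDegree * D) =
      D * (bias γ α * q * (p k / G.sameDegree k - 1 / G.totalDegree)) +
        (1 - q) * (∑ w, G.pickProb w * G.connectProb γ α (G.group w) w * r w) := by ring
  rw [heq]
  refine (abs_add_le _ _).trans (add_le_add hbias ?_)
  rw [abs_mul, abs_of_nonneg (sub_nonneg.2 hq1)]
  exact (mul_le_of_le_one_left (abs_nonneg _) (by linarith)).trans hloop

end Share

end Network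

/-! ### Deterministic recursions and the Gamma asymptotics -/

/-- Up to a constant, `|y t|` is at most the sum of the errors, and the Cesàro means of a null
sequence tend to zero. -/
theorem tendsto_div_zero_of_abs_succ_le {y ε : ℕ → ℝ} (hε : Tendsto ε atTop (𝓝 0))
    (h : ∀ᶠ t in atTop, |y (t + 1)| ≤ |y t| + |ε t|) :
    Tendsto (fun t : ℕ => y t / t) atTop (𝓝 0) := by
  obtain ⟨N, hN⟩ := eventually_atTop.1 h
  have hbound : ∀ n, |y (N + n)| ≤ |y N| + ∑ i ∈ Finset.range (N + n), |ε i| := by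
    intro n
    induction n with
    | zero => exact le_add_of_nonneg_right (Finset.sum_nonneg fun _ _ => abs_nonneg _)
    | succ n ih =>
      rw [← add_assoc, Finset.sum_range_succ]
      linarith [hN (N + n) (Nat.le_add_right _ _)]
  have hces : Tendsto (fun t : ℕ => (t : ℝ)⁻¹ * ∑ i ∈ Finset.range t, |ε i|) atTop (𝓝 0) := by
    have := hε.abs.cesaro
    rwa [abs_zero] at this
  have hinv : Tendsto (fun t : ℕ => |y N| * (t : ℝ)⁻¹) atTop (𝓝 0) := by
    simpa using (tendsto_inv_atTop_nhds_zero_nat (𝕜 := ℝ)).const_mul |y N|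
  have hsum := hinv.add hces
  rw [add_zero] at hsum
  refine squeeze_zero_norm' ?_ hsum
  filter_upwards [eventually_ge_atTop N] with t ht
  obtain ⟨n, rfl⟩ := Nat.exists_eq_add_of_le ht
  rw [Real.norm_eq_abs, abs_div, Nat.abs_cast, div_eq_inv_mul, mul_comm |y N|, ← mul_add]
  exact mul_le_mul_of_nonneg_left (hbound n) (inv_nonneg.2 (Nat.cast_nonneg _))

/-- The linear growth rate of the solutions of a linear recursion of first order. -/
theorem tendsto_div_of_linear_recursion {e r : ℕ → ℝ} {b c ρ : ℝ} (hb : 0 ≤ b) (hc : 0 < c)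
    (hr : Tendsto r atTop (𝓝 ρ)) (he : ∀ t : ℕ, e (t + 1) = (1 - b / (t + c)) * e t + r t) :
    Tendsto (fun t : ℕ => e t / t) atTop (𝓝 (ρ / (1 + b))) := by
  have h1b : (1 + b) ≠ 0 := by positivity
  set m := ρ / (1 + b) with hm
  have hρ : ρ = m * (1 + b) := by rw [hm]; field_simp
  -- For constant `r = ρ` the line `m * (t + c)` solves the recursion exactly; subtracting it leaves
  -- an equation driven by a null sequence.
  let y : ℕ → ℝ := fun t => e t - m * (t + c)
  have hy : ∀ t : ℕ, y (t + 1) = (1 - b / (t + c)) * y t + (r t - ρ) := fun t => by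
    have ht : (t : ℝ) + c ≠ 0 := by positivity
    simp only [y, he, hρ]
    push_cast
    field_simp
    ring
  have hε : Tendsto (fun t => r t - ρ) atTop (𝓝 0) := by simpa using hr.sub_const ρ
  have hlim : Tendsto (fun t : ℕ => y t / t) atTop (𝓝 0) := by
    refine tendsto_div_zero_of_abs_succ_le hε ?_
    -- From time `b` on, the factor `1 - b / (t + c)` lies in `[0, 1]` and cannot enlarge `|y|`.
    filter_upwards [eventually_ge_atTop ⌈b⌉₊] with t ht
    have hbt : b ≤ t + c := (Nat.ceil_le.1 ht).trans (by linarith)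
    have hpos : 0 < (t : ℝ) + c := by positivity
    have h1 : b / (t + c) ≤ 1 := (div_le_one hpos).2 hbt
    have h2 : 0 ≤ b / (t + c) := by positivity
    rw [hy]
    refine (abs_add_le _ _).trans (add_le_add_left ?_ _)
    rw [abs_mul]
    exact mul_le_of_le_one_left (abs_nonneg _) (abs_le.2 ⟨by linarith, by linarith⟩)
  have hinv : Tendsto (fun t : ℕ => m + m * c * (t : ℝ)⁻¹) atTop (𝓝 m) := by
    simpa using ((tendsto_inv_atTop_nhds_zero_nat (𝕜 := ℝ)).const_mul (m * c)).const_add m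
  have hsum := hlim.add hinv
  rw [zero_add] at hsum
  refine hsum.congr' ?_
  filter_upwards [eventually_gt_atTop 0] with t ht
  have ht' : (t : ℝ) ≠ 0 := by positivity
  simp only [y]
  field_simp
  ring

/-- With `s = 2 - q/2`, Bernoulli's inequality lets `T^s` grow by the factor `1 + (4 - q) / T`. The
surplus `q / T` over the recursion, multiplied by `4/q * T^s`, is `4 * T^(s-1) ≥ 4` and pays for the
additive constant. -/
theorem le_rpow_of_succ_le {Y : ℕ → ℝ} {n q : ℝ} (hn : 1 ≤ n) (hq0 : 0 < q) (hq1 : q ≤ 1)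
    (h0 : Y 0 = 0) (h : ∀ t : ℕ, Y (t + 1) ≤ (1 + (4 - 2 * q) / (n + 2 * t)) * Y t + 4) (t : ℕ) :
    Y t ≤ 4 / q * (n + 2 * t) ^ (2 - q / 2) := by
  induction t with
  | zero => rw [h0]; positivity
  | succ t ih =>
    have hT : 1 ≤ n + 2 * (t : ℝ) := by linarith [Nat.cast_nonneg (α := ℝ) t]
    have hsucc : n + 2 * ((t + 1 : ℕ) : ℝ) = (n + 2 * t) + 2 := by push_cast; ring
    have ht := h t
    rw [hsucc]
    generalize n + 2 * (t : ℝ) = T at hT ih ht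
    have hTpos : 0 < T := by linarith
    set s := 2 - q / 2 with hs
    have hbern : T ^ s * (1 + s * (2 / T)) ≤ (T + 2) ^ s := by
      have h1 := one_add_mul_self_le_rpow_one_add (s := 2 / T)
        (by linarith [div_pos two_pos hTpos]) (p := s) (by linarith)
      have h2 : T + 2 = T * (1 + 2 / T) := by field_simp
      rw [h2, Real.mul_rpow hTpos.le (by positivity)]
      exact mul_le_mul_of_nonneg_left h1 (by positivity)
    have hpow : T ≤ T ^ s := by
      simpa using Real.rpow_le_rpow_of_exponent_le hT (show (1 : ℝ) ≤ s by linarith)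
    have h1 : 1 ≤ T ^ s / T := (one_le_div hTpos).2 hpow
    have hcoef : 0 ≤ 1 + (4 - 2 * q) / T := by
      have : 0 ≤ (4 - 2 * q) / T := div_nonneg (by linarith) hTpos.le
      linarith
    have h2 : 4 / q * (T ^ s * (1 + s * (2 / T))) =
        (1 + (4 - 2 * q) / T) * (4 / q * T ^ s) + 4 * (T ^ s / T) := by
      rw [hs]; field_simp; ring
    have h3 := mul_le_mul_of_nonneg_left hbern (show 0 ≤ 4 / q by positivity)
    have h4 := mul_le_mul_of_nonneg_left ih hcoef
    linarith

/-- Brings the product to the shape of Euler's sequence `Real.GammaSeq`; `s * (s + 1)` are the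
factors `j = 0, 1` of the denominator that the product from 2 lacks. -/
theorem prod_Icc_mul_prod_range {s : ℝ} (hs : 0 < s) (n : ℕ) :
    (∏ j ∈ Finset.Icc 2 (n + 1), ((j : ℝ) - 1) / (s + j)) * ∏ j ∈ Finset.range (n + 2), (s + j) =
      s * (s + 1) * (n.factorial : ℝ) := by
  induction n with
  | zero => simp [Finset.prod_range_succ]
  | succ n ih =>
    rw [Finset.prod_Icc_succ_top (by omega), Finset.prod_range_succ, Nat.factorial_succ]
    have : s + ((n + 2 : ℕ) : ℝ) ≠ 0 := by positivity
    have e : ((n + 1 + 1 : ℕ) : ℝ) = ((n + 2 : ℕ) : ℝ) := rfl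
    rw [e]
    calc _ = ((∏ j ∈ Finset.Icc 2 (n + 1), ((j : ℝ) - 1) / (s + j)) *
          ∏ j ∈ Finset.range (n + 2), (s + (j : ℝ))) * (((n + 2 : ℕ) : ℝ) - 1) *
            ((s + ((n + 2 : ℕ) : ℝ)) / (s + ((n + 2 : ℕ) : ℝ))) := by ring
      _ = _ := by rw [ih, div_self this]; push_cast; ring

theorem prod_Icc_isEquivalent {s : ℝ} (hs : 0 < s) :
    (fun d : ℕ => ∏ j ∈ Finset.Icc 2 d, ((j : ℝ) - 1) / (s + j)) ~[atTop]
      fun d : ℕ => s * (s + 1) * Real.Gamma s * (d : ℝ) ^ (-(1 + s)) := by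
  have hΓ := Real.Gamma_pos_of_pos hs
  have heq : (fun d : ℕ => ∏ j ∈ Finset.Icc 2 d, ((j : ℝ) - 1) / (s + j)) =ᶠ[atTop]
      fun d : ℕ => s * (s + 1) * Real.GammaSeq s d * (d : ℝ) ^ (-(1 + s)) := by
    filter_upwards [eventually_ge_atTop 1] with d hd
    obtain ⟨n, rfl⟩ : ∃ n, d = n + 1 := ⟨d - 1, by omega⟩
    have hprod : (0 : ℝ) < ∏ j ∈ Finset.range (n + 2), (s + (j : ℝ)) :=
      Finset.prod_pos fun j _ => by positivity
    have hn : (0 : ℝ) < ((n + 1 : ℕ) : ℝ) := by positivity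
    rw [eq_div_of_mul_eq hprod.ne' (prod_Icc_mul_prod_range hs n), Real.GammaSeq,
      Real.rpow_neg hn.le, Real.rpow_add hn, Real.rpow_one, Nat.factorial_succ]
    have hpow := (Real.rpow_pos_of_pos hn s).ne'
    push_cast at hn hpow hprod ⊢
    field_simp
  refine IsEquivalent.congr_left ?_ heq.symm
  refine IsEquivalent.mul ?_ IsEquivalent.refl
  refine (isEquivalent_const_iff_tendsto (by positivity)).2 ?_
  exact (Real.GammaSeq_tendsto_Gamma s).const_mul _

/-! ### Balance of the groups in mean and convergence of the degree counts -/

namespace IsKPAProcess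

open Network

variable {Ω : Type*} [MeasurableSpace Ω] {P : Measure Ω} [IsProbabilityMeasure P] {K n₀ : ℕ}
  {q : ℝ} {p : Fin K → ℝ} {γ α : ℝ} {σ : Fin n₀ → Fin K} {G : ℕ → Ω → Network K n₀}

theorem integral_excess_sq_le (hn₀ : 0 < n₀) (hq0 : 0 < q) (hq1 : q ≤ 1) (hp0 : ∀ k, 0 ≤ p k)
    (hp1 : ∑ k, p k = 1) (hγ0 : 0 < γ) (hγ1 : γ ≤ 1) (hα0 : 0 < α) (hα1 : α ≤ 1)
    (hσ : ∀ k, (((Finset.univ.filter (fun i => σ i = k)).card : ℕ) : ℝ) = p k * (n₀ : ℝ))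
    (hG : IsKPAProcess P q p γ α σ G) (k : Fin K) (t : ℕ) :
    ∫ ω, excess p k (G t ω) ^ 2 ∂P ≤ 4 / q * ((n₀ : ℝ) + 2 * t) ^ (2 - q / 2) := by
  have had := ae_reachable hn₀ hp0 hσ hG
  have hr : ∀ᵐ ω ∂P, ∀ t, G t ω ∈ reachable σ t := had.mono fun ω h t => (h t).1
  refine le_rpow_of_succ_le (Y := fun t => ∫ ω, excess p k (G t ω) ^ 2 ∂P)
    (by exact_mod_cast hn₀) hq0 hq1 ?_ (fun t => ?_) t
  -- Initially all degrees are one and the group sizes are exactly `p k * n₀`, so the excess starts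
  -- at zero.
  · refine integral_eq_zero_of_ae ?_
    filter_upwards [hG.start] with ω h
    have hT := (Admissible.initial hn₀ σ hσ).totalDegree_eq
    rw [h, excess, sameDegree_initial, hσ, hT]
    simp
  · have hint := integrable_comp hG hr t fun a => excess p k a ^ 2
    change ∫ ω, excess p k (G (t + 1) ω) ^ 2 ∂P ≤
      (1 + (4 - 2 * q) / (n₀ + 2 * t)) * ∫ ω, excess p k (G t ω) ^ 2 ∂P + 4
    have hrhs : ∫ ω, ((1 + (4 - 2 * q) / (n₀ + 2 * t)) * excess p k (G t ω) ^ 2 + 4) ∂P =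
        (1 + (4 - 2 * q) / (n₀ + 2 * t)) * ∫ ω, excess p k (G t ω) ^ 2 ∂P + 4 := by
      rw [integral_add (hint.const_mul _) (integrable_const _), integral_const_mul]
      simp
    rw [integral_succ hG hr t fun a => excess p k a ^ 2, ← hrhs]
    refine integral_mono_ae (integrable_comp hG hr t _)
      ((hint.const_mul _).add (integrable_const _)) ?_
    filter_upwards [had] with ω h
    exact stepMean_excess_sq_le hn₀ hq0.le hq1 hp0 hp1 hγ0 hγ1 hα0 hα1 (h t).2 k

theorem tendsto_time_inv (n : ℝ) : Tendsto (fun t : ℕ => (n + 2 * (t : ℝ))⁻¹) atTop (𝓝 0) :=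
  tendsto_inv_atTop_zero.comp <| tendsto_atTop_add_const_left _ _ <|
    tendsto_natCast_atTop_atTop.const_mul_atTop two_pos

theorem tendsto_mul_integral_abs_excess (hn₀ : 0 < n₀) (hq0 : 0 ≤ q) (hq1 : q ≤ 1)
    (hp0 : ∀ k, 0 ≤ p k) (hp1 : ∑ k, p k = 1) (hγ0 : 0 < γ) (hγ1 : γ ≤ 1) (hα0 : 0 < α)
    (hα1 : α ≤ 1)
    (hσ : ∀ k, (((Finset.univ.filter (fun i => σ i = k)).card : ℕ) : ℝ) = p k * (n₀ : ℝ))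
    (hG : IsKPAProcess P q p γ α σ G) (k : Fin K) :
    Tendsto (fun t : ℕ => q * ∫ ω, |excess p k (G t ω)| / ((n₀ : ℝ) + 2 * t) ∂P) atTop
      (𝓝 0) := by
  have had := ae_reachable hn₀ hp0 hσ hG
  have hr : ∀ᵐ ω ∂P, ∀ t, G t ω ∈ reachable σ t := had.mono fun ω h t => (h t).1
  rcases hq0.eq_or_lt with hq | hq
  · simp [← hq]
  have hlim : Tendsto (fun t : ℕ => q * ((4 / q + 1) * ((n₀ : ℝ) + 2 * t)⁻¹ ^ (q / 4))) atTop
      (𝓝 0) := by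
    have := (((tendsto_time_inv n₀).rpow_const (p := q / 4) (Or.inr (by positivity))).const_mul
      (4 / q + 1)).const_mul q
    rwa [Real.zero_rpow (by positivity), mul_zero, mul_zero] at this
  refine squeeze_zero (fun t => mul_nonneg hq0 (integral_nonneg fun ω => by positivity))
    (fun t => mul_le_mul_of_nonneg_left ?_ hq0) hlim
  have hsq := integral_excess_sq_le hn₀ hq hq1 hp0 hp1 hγ0 hγ1 hα0 hα1 hσ hG k t
  have hn₀' : (0 : ℝ) < n₀ := by exact_mod_cast hn₀
  have hT : (0 : ℝ) < n₀ + 2 * t := by positivity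
  generalize (n₀ : ℝ) + 2 * t = T at hT hsq
  -- The scale `m = T^(1 - q/4)` is the square root of the second-moment rate. Then `|y| ≤ y^2 / m +
  -- m` bounds `E|y|` by a multiple of `m`, which is `o(T)`.
  have hm : 0 < T ^ (1 - q / 4) := Real.rpow_pos_of_pos hT _
  have hmm : T ^ (2 - q / 2) = T ^ (1 - q / 4) * T ^ (1 - q / 4) := by
    rw [← Real.rpow_add hT]; congr 1; ring
  have hTm : T⁻¹ ^ (q / 4) = T ^ (1 - q / 4) / T := by
    rw [Real.rpow_sub hT, Real.rpow_one, Real.inv_rpow hT.le]; field_simp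
  rw [integral_div, hTm, ← mul_div_assoc]
  refine div_le_div_of_nonneg_right ?_ hT.le
  rw [hmm] at hsq
  generalize T ^ (1 - q / 4) = m at hm hsq
  have hint := integrable_comp hG hr t fun a => excess p k a ^ 2
  calc ∫ ω, |excess p k (G t ω)| ∂P ≤ ∫ ω, (excess p k (G t ω) ^ 2 / m + m) ∂P := by
        refine integral_mono (integrable_comp hG hr t fun a => |excess p k a|)
          ((hint.div_const m).add (integrable_const m)) fun ω => ?_
        change |excess p k (G t ω)| ≤ excess p k (G t ω) ^ 2 / m + m
        rw [← sq_abs, div_add' _ _ _ hm.ne', le_div_iff₀ hm]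
        nlinarith [sq_nonneg (|excess p k (G t ω)| - m), abs_nonneg (excess p k (G t ω))]
    _ = (∫ ω, excess p k (G t ω) ^ 2 ∂P) / m + m := by
        rw [integral_add (hint.div_const m) (integrable_const m), integral_div]
        simp
    _ ≤ 4 / q * (m * m) / m + m := by gcongr
    _ = (4 / q + 1) * m := by field_simp

/-- The limit of the mean number of nodes of degree `d`, divided by the time, in a group of
weight `a`. -/
noncomputable def degreeDensity (q a : ℝ) (d : ℕ) : ℝ :=
  2 * q * a / (4 - q) *
    ∏ j ∈ Finset.Icc 2 d, (((j : ℝ) - 1) * (2 - q) / (2 + (j : ℝ) * (2 - q)))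

theorem degreeDensity_isEquivalent {q a : ℝ} (hq0 : 0 < q) (hq1 : q ≤ 1) (ha : 0 < a) :
    ∃ C : ℝ, 0 < C ∧
      degreeDensity q a ~[atTop] fun d : ℕ => C * (d : ℝ) ^ (-(1 + 2 / (2 - q))) := by
  have hq2 : 0 < 2 - q := by linarith
  have hs : 0 < 2 / (2 - q) := by positivity
  have h4 : 0 < 4 - q := by linarith
  have hΓ := Real.Gamma_pos_of_pos hs
  refine ⟨2 * q * a / (4 - q) * (2 / (2 - q) * (2 / (2 - q) + 1) * Real.Gamma (2 / (2 - q))),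
    by positivity, ?_⟩
  have h := (IsEquivalent.refl (u := fun _ : ℕ => 2 * q * a / (4 - q)) (l := atTop)).mul
    (prod_Icc_isEquivalent hs)
  refine (h.congr_left (Eventually.of_forall fun d => ?_)).congr_right
    (Eventually.of_forall fun d => ?_)
  · simp only [Pi.mul_apply, degreeDensity]
    congr 1
    refine Finset.prod_congr rfl fun j _ => ?_
    have : 0 < 2 + (j : ℝ) * (2 - q) := by positivity
    have : 0 < 2 / (2 - q) + (j : ℝ) := by positivity
    field_simp
  · simp only [Pi.mul_apply, mul_assoc]

theorem degreeDensity_succ {q : ℝ} (hq1 : q ≤ 1) (a : ℝ) {d : ℕ} (hd : 1 ≤ d) :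
    degreeDensity q a (d + 1) =
      ((2 - q) * d * (degreeDensity q a d / 2)) / (1 + (2 - q) * ((d + 1 : ℕ) : ℝ) / 2) := by
  have : 0 < 2 - q := by linarith
  have : 0 < 2 + ((d + 1 : ℕ) : ℝ) * (2 - q) := by positivity
  have : 0 < 1 + (2 - q) * ((d + 1 : ℕ) : ℝ) / 2 := by positivity
  rw [degreeDensity, Finset.prod_Icc_succ_top (by omega), ← mul_assoc, ← degreeDensity]
  push_cast at *
  field_simp
  ring

theorem tendsto_integral_countDegree (hn₀ : 0 < n₀) (hq0 : 0 ≤ q) (hq1 : q ≤ 1)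
    (hp0 : ∀ k, 0 ≤ p k) (hp1 : ∑ k, p k = 1) (hγ0 : 0 < γ) (hγ1 : γ ≤ 1) (hα0 : 0 < α)
    (hα1 : α ≤ 1)
    (hσ : ∀ k, (((Finset.univ.filter (fun i => σ i = k)).card : ℕ) : ℝ) = p k * (n₀ : ℝ))
    (hG : IsKPAProcess P q p γ α σ G) (k : Fin K) {d : ℕ} (hd : 1 ≤ d) :
    Tendsto (fun t : ℕ => (∫ ω, ((G t ω).countDegree k d : ℝ) ∂P) / (t : ℝ)) atTop
      (𝓝 (degreeDensity q (p k) d)) := by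
  have had := ae_reachable hn₀ hp0 hσ hG
  have hr : ∀ᵐ ω ∂P, ∀ t, G t ω ∈ reachable σ t := had.mono fun ω h t => (h t).1
  have hn₀' : (0 : ℝ) < n₀ := by exact_mod_cast hn₀
  have hT : ∀ t : ℕ, (0 : ℝ) < n₀ + 2 * t := fun t => by positivity
  -- `e` is the mean count and `err` the defect in the recursion of pure preferential attachment.
  let e : ℕ → ℕ → ℝ := fun d t => ∫ ω, ((G t ω).countDegree k d : ℝ) ∂P
  let err : ℕ → ℕ → ℝ := fun d t => e d (t + 1) - (e d t + q * p k * (if d = 1 then 1 else 0) +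
    (2 - q) / (n₀ + 2 * t) * (((d : ℝ) - 1) * e (d - 1) t - d * e d t))
  have herr : ∀ d, 1 ≤ d → Tendsto (err d) atTop (𝓝 0) := fun d hd => by
    have hlim := (tendsto_mul_integral_abs_excess hn₀ hq0 hq1 hp0 hp1 hγ0 hγ1 hα0 hα1 hσ hG
      k).add ((tendsto_time_inv n₀).const_mul (2 * (d : ℝ)))
    rw [mul_zero, add_zero] at hlim
    refine squeeze_zero_norm (fun t => ?_) hlim
    have hi : ∀ f : Network K n₀ → ℝ, Integrable (fun ω => f (G t ω)) P :=
      integrable_comp hG hr t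
    have hmain : err d t = ∫ ω, (stepMean q p γ α (fun a => (a.countDegree k d : ℝ)) (G t ω) -
        ((G t ω).countDegree k d + q * p k * (if d = 1 then 1 else 0) +
          (2 - q) / (n₀ + 2 * t) * (((d : ℝ) - 1) * (G t ω).countDegree k (d - 1) -
            d * (G t ω).countDegree k d))) ∂P := by
      rw [integral_sub (hi _) (hi fun a => (a.countDegree k d : ℝ) +
            q * p k * (if d = 1 then 1 else 0) + (2 - q) / (n₀ + 2 * t) *
              (((d : ℝ) - 1) * a.countDegree k (d - 1) - d * a.countDegree k d)),
        ← integral_succ hG hr,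
        integral_add (hi fun a => (a.countDegree k d : ℝ) + q * p k * (if d = 1 then 1 else 0))
          (hi fun a => (2 - q) / (n₀ + 2 * t) *
            (((d : ℝ) - 1) * a.countDegree k (d - 1) - d * a.countDegree k d)),
        integral_add (hi fun a => (a.countDegree k d : ℝ)) (integrable_const _),
        integral_const_mul ((2 - q) / (n₀ + 2 * t) : ℝ),
        integral_sub (hi fun a => ((d : ℝ) - 1) * a.countDegree k (d - 1))
          (hi fun a => (d : ℝ) * a.countDegree k d), integral_const_mul ((d : ℝ) - 1),
        integral_const_mul (d : ℝ)]
      simp [err, e]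
    have hbound : ∫ ω, (q * (|excess p k (G t ω)| / ((n₀ : ℝ) + 2 * t)) +
        2 * d * ((n₀ : ℝ) + 2 * t)⁻¹) ∂P =
        q * ∫ ω, |excess p k (G t ω)| / ((n₀ : ℝ) + 2 * t) ∂P +
          2 * d * ((n₀ : ℝ) + 2 * t)⁻¹ := by
      rw [integral_add ((hi fun a => |excess p k a| / ((n₀ : ℝ) + 2 * t)).const_mul q)
        (integrable_const _), integral_const_mul]
      simp
    rw [hmain, ← hbound]
    refine norm_integral_le_of_norm_le
      (((hi fun a => |excess p k a| / ((n₀ : ℝ) + 2 * t)).const_mul q).add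
        (integrable_const _)) ?_
    filter_upwards [had] with ω h
    refine (abs_stepMean_countDegree_le hn₀ hq0 hq1 hp0 hp1 hγ0 hγ1 hα0 hα1 (h t).2 k
      hd).trans_eq ?_
    ring
  -- Since `(2 - q) * d / (n₀ + 2t) = ((2 - q) * d / 2) / (t + n₀/2)`, the linear recursion applies
  -- with `b = (2 - q) * d / 2` and `c = n₀ / 2`.
  have hrec : ∀ d, 1 ≤ d → ∀ ρ, Tendsto (fun t : ℕ => err d t +
      (q * p k * (if d = 1 then 1 else 0) + (2 - q) * ((d : ℝ) - 1) *
        (e (d - 1) t / (n₀ + 2 * t)))) atTop (𝓝 ρ) →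
      Tendsto (fun t : ℕ => e d t / t) atTop (𝓝 (ρ / (1 + (2 - q) * d / 2))) := by
    intro d hd ρ hρ
    refine tendsto_div_of_linear_recursion (c := n₀ / 2) ?_ (by positivity) hρ fun t => ?_
    · have : 0 < 2 - q := by linarith
      positivity
    · have := (hT t).ne'
      have h2 : (t : ℝ) + n₀ / 2 = (n₀ + 2 * t) / 2 := by ring
      rw [h2]
      simp only [err]
      field_simp
      ring
  change Tendsto (fun t : ℕ => e d t / t) atTop _
  induction d, hd using Nat.le_induction with
  | base =>
    -- At `d = 1` the inflow has coefficient `d - 1 = 0`, so the count of degree 0 plays no role.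
    have h := hrec 1 le_rfl (q * p k) (by simpa using (herr 1 le_rfl).add_const (q * p k))
    convert h using 2
    have : 4 - q ≠ 0 := by linarith
    have hden : 1 + (2 - q) * ((1 : ℕ) : ℝ) / 2 = (4 - q) / 2 := by push_cast; ring
    rw [hden, degreeDensity, Finset.Icc_eq_empty (by norm_num), Finset.prod_empty]
    field_simp
  | succ d hd ih =>
    -- The total degree grows like `2t`, hence half of the limit of `e d t / t`.
    have hhalf : Tendsto (fun t : ℕ => e d t / (n₀ + 2 * t)) atTop
        (𝓝 (degreeDensity q (p k) d / 2)) := by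
      have hfrac : Tendsto (fun t : ℕ => (1 - n₀ * ((n₀ : ℝ) + 2 * t)⁻¹) / 2) atTop
          (𝓝 (1 / 2)) := by
        simpa using (((tendsto_time_inv n₀).const_mul (n₀ : ℝ)).const_sub 1).div_const 2
      have := ih.mul hfrac
      rw [mul_one_div] at this
      refine this.congr' ?_
      filter_upwards [eventually_gt_atTop 0] with t ht
      have ht' : (t : ℝ) ≠ 0 := by positivity
      have := (hT t).ne'
      field_simp
      ring
    have h := hrec (d + 1) (by omega) ((2 - q) * d * (degreeDensity q (p k) d / 2)) (by
      have := (herr (d + 1) (by omega)).add (hhalf.const_mul ((2 - q) * d))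
      simpa [show d ≠ 0 by omega] using this)
    rwa [degreeDensity_succ hq1 _ hd]

end IsKPAProcess

theorem theorem3 {Ω : Type*} [MeasurableSpace Ω] (P : Measure Ω) [IsProbabilityMeasure P]
    (K n₀ : ℕ) (hn₀ : 0 < n₀)
    (q : ℝ) (hq0 : 0 ≤ q) (hq1 : q ≤ 1)
    (p : Fin K → ℝ) (hp0 : ∀ k, 0 ≤ p k) (hp1 : ∑ k, p k = 1)
    (γ : ℝ) (hγ0 : 0 < γ) (hγ1 : γ ≤ 1)
    (α : ℝ) (hα0 : 0 < α) (hα1 : α ≤ 1)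
    (σ : Fin n₀ → Fin K)
    (hσ : ∀ k, (((Finset.univ.filter (fun i => σ i = k)).card : ℕ) : ℝ) = p k * (n₀ : ℝ))
    (G : ℕ → Ω → Network K n₀) (hG : IsKPAProcess P q p γ α σ G) :
    (∀ k, ∀ᵐ ω ∂P, ((G 0 ω).countDegree k 1 : ℝ) = p k * (n₀ : ℝ)) ∧
    (∀ k t, ∀ᵐ ω ∂P, (G t ω).countDegree k 0 = 0) ∧
    ∃ M : Fin K → ℕ → ℝ, ∀ k,
      (∀ d : ℕ, 1 ≤ d →
        (∀ t, Integrable (fun ω => ((G t ω).countDegree k d : ℝ)) P) ∧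
        Tendsto (fun t : ℕ => (∫ ω, ((G t ω).countDegree k d : ℝ) ∂P) / (t : ℝ)) atTop
          (𝓝 (M k d)) ∧
        M k d = 2 * q * p k / (4 - q) *
          ∏ j ∈ Finset.Icc 2 d, (((j : ℝ) - 1) * (2 - q) / (2 + (j : ℝ) * (2 - q)))) ∧
      (0 < q → 0 < p k →
        ∃ C : ℝ, 0 < C ∧
          (fun d : ℕ => M k d) ~[atTop] (fun d : ℕ => C * (d : ℝ) ^ (-(1 + 2 / (2 - q))))) := by
  have had := IsKPAProcess.ae_reachable hn₀ hp0 hσ hG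
  have hr : ∀ᵐ ω ∂P, ∀ t, G t ω ∈ Network.reachable σ t := had.mono fun ω h t => (h t).1
  refine ⟨fun k => ?_, fun k t => ?_, fun k => IsKPAProcess.degreeDensity q (p k), fun k =>
    ⟨fun d hd => ⟨fun t => IsKPAProcess.integrable_comp hG hr t fun a => (a.countDegree k d : ℝ),
      IsKPAProcess.tendsto_integral_countDegree hn₀ hq0 hq1 hp0 hp1 hγ0 hγ1 hα0 hα1 hσ hG k hd,
      rfl⟩, fun hq hpk => IsKPAProcess.degreeDensity_isEquivalent hq hq1 hpk⟩⟩
  · filter_upwards [hG.start] with ω h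
    rw [h, Network.countDegree_initial, hσ]
  · filter_upwards [had] with ω h
    exact (h t).2.countDegree_zero k
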